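/- **Setting.** Let $N,n,m\ge 0$ be integers, $(\Omega,\mathfrak F,\mathbb P)$ a probability space and $\omega_0,\dots,\omega_{N-1}$ real random variables. For $0\le l<N$ and a random vector $\xi:\Omega\to\mathbb R^n$ put $\mathfrak F^{l,\xi}_{k}=\sigma(\xi,\omega_l,\dots,\omega_{k-1})$ (the information available when the control at time $k$ is chosen; $\mathfrak F^{l,\xi}_l=\sigma(\xi)$). Call $\xi$ an *initial state at time $l$*, and $(l,\xi)$ an *initial pair*, if $\mathbb E|\xi|^2<\infty$ and $\mathbb E[\omega_k\mid\mathfrak F^{l,\xi}_k]=0$, $\mathbb E[\omega_k^2\mid\mathfrak F^{l,\xi}_k]=1$ for $l\le k<N$ (if these two identities hold for constant $\xi$ at $l=0$, then every square integrable $\xi$ independent of $(\omega_k)$ is an initial state at every time). Let $\mathscr U_{ad}(l,\xi)$ be the set of $u=(u_l,\dots,u_{N-1})$ with $u_k:\Omega\to\mathbb R^m$ square integrable and $\mathfrak F^{l,\xi}_{k}$-measurable. Let $A_k,\bar A_k,C_k,\bar C_k,Q_k,\bar Q_k,G,\bar G\in\mathbb R^{n\times n}$, $B_k,\bar B_k,D_k,\bar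 D_k,S_k,\bar S_k\in\mathbb R^{n\times m}$, $R_k,\bar R_k\in\mathbb R^{m\times m}$ and $b_k,\sigma_k\in\mathbb R^n$ be deterministic, with $Q_k,\bar Q_k,R_k,\bar R_k,G,\bar G$ symmetric (not necessarily definite). Let $g,\bar g,q_k,\bar q_k$ ($\mathbb R^n$-valued) and $\rho_k,\bar\rho_k$ ($\mathbb R^m$-valued) be square integrable random vectors. For $u\in\mathscr U_{ad}(l,\xi)$ let $x_l=\xi$ and, for $l\le k<N$, $$x_{k+1}=A_kx_k+\bar A_k\mathbb Ex_k+B_ku_k+\bar B_k\mathbb Eu_k+b_k+(C_kx_k+\bar C_k\mathbb Ex_k+D_ku_k+\bar D_k\mathbb Eu_k+\sigma_k)\omega_k ,\qquad(1)$$ $$\begin{aligned}J(l,\xi;u)=\mathbb E\Big\{&\langle Gx_N,x_N\rangle+2\langle g,x_N\rangle+\langle\bar G\mathbb Ex_N,\mathbb Ex_N\rangle+2\langle\bar g,\mathbb Ex_N\rangle\\&+\sum_{k=l}^{N-1}\big[\langle Q_kx_k,x_k\rangle+2\langle S_ku_k,x_k\rangle+\langle R_ku_k,u_k\rangle+2\langle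 q_k,x_k\rangle+2\langle\rho_k,u_k\rangle\\&+\langle\bar Q_k\mathbb Ex_k,\mathbb Ex_k\rangle+2\langle\bar S_k\mathbb Eu_k,\mathbb Ex_k\rangle+\langle\bar R_k\mathbb Eu_k,\mathbb Eu_k\rangle+2\langle\bar q_k,\mathbb Ex_k\rangle+2\langle\bar\rho_k,\mathbb Eu_k\rangle\big]\Big\}.\end{aligned}$$ Problem (MF-LQ) at $(l,\xi)$ is to minimize $J(l,\xi;\cdot)$ over $\mathscr U_{ad}(l,\xi)$; a minimizer is an *open-loop optimal control*, and the problem is *uniquely open-loop solvable* at $(l,\xi)$ if there is exactly one, up to almost sure equality. $J^0$ denotes the functional $J$ with $b,\sigma,g,\bar g,q,\bar q,\rho,\bar\rho$ replaced by $0$; in $J^0(l,0;u)$ the state starts from $x_l=0$. **Equations.** $M^\dagger$ is the Moore–Penrose inverse. For $k<N$ write $$\Upsilon_k=R_k+B_k'P_{k+1}B_k+D_k'P_{k+1}D_k,\qquad H_k=B_k'P_{k+1}A_k+D_k'P_{k+1}C_k+S_k',$$ $$\bar\Upsilon_k=R_k+\bar R_k+(B_k+\bar B_k)'\Pi_{k+1}(B_k+\bar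 B_k)+(D_k+\bar D_k)'P_{k+1}(D_k+\bar D_k),$$ $$\bar H_k=(B_k+\bar B_k)'\Pi_{k+1}(A_k+\bar A_k)+(D_k+\bar D_k)'P_{k+1}(C_k+\bar C_k)+S_k'+\bar S_k'.$$ The generalized Riccati equations (GRE) for $(P_k,\Pi_k)_{0\le k\le N}$ are $P_N=G$, $\Pi_N=G+\bar G$ and, for $k<N$, $$P_k=Q_k+A_k'P_{k+1}A_k+C_k'P_{k+1}C_k-H_k'\Upsilon_k^\dagger H_k,$$ $$\Pi_k=Q_k+\bar Q_k+(A_k+\bar A_k)'\Pi_{k+1}(A_k+\bar A_k)+(C_k+\bar C_k)'P_{k+1}(C_k+\bar C_k)-\bar H_k'\bar\Upsilon_k^\dagger\bar H_k.$$ A solution is *strongly regular* if for some $\alpha>0$, $\Upsilon_k\ge\alpha I$ and $\bar\Upsilon_k\ge\alpha I$ for all $k<N$. When $g,\bar g,q,\bar q,\rho,\bar\rho$ are deterministic, the linear recursive equation (LRE) for $(\eta_k)_{0\le k\le N}$ is $\eta_N=g+\bar g$ and, for $k<N$, $$\eta_k=(C_k+\bar C_k)'P_{k+1}\sigma_k+(A_k+\bar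 A_k)'(\Pi_{k+1}b_k+\eta_{k+1})-\bar H_k'\bar\Upsilon_k^\dagger\zeta_k+q_k+\bar q_k,$$ $$\zeta_k=(D_k+\bar D_k)'P_{k+1}\sigma_k+(B_k+\bar B_k)'(\Pi_{k+1}b_k+\eta_{k+1})+\rho_k+\bar\rho_k.$$ **Corollary 4.2.** Let $\xi_0$ be an initial state at time $0$ that is not almost surely constant, and assume (A2) there is $\alpha>0$ such that $J^0(0,0;u)\ge\alpha\,\mathbb E\sum_{k=0}^{N-1}|u_k|^2$ for all $u\in\mathscr U_{ad}(0,\xi_0)$. Then: 1. The GRE has a unique strongly regular solution $(P,\Pi)$. 2. For all square integrable random $g,\bar g,q_k,\bar q_k,\rho_k,\bar\rho_k$, Problem (MF-LQ) is uniquely open-loop solvable at every initial pair $(l,\xi)$, $0\le l<N$. 3. If $g,\bar g,q,\bar q,\rho,\bar\rho$ are deterministic, the LRE has a unique solution $\eta$, and for every initial pair $(l,\xi)$ the unique open-loop optimal control $u^*$ is given, for $l\le k<N$, by $$u_k^*=-\Upsilon_k^\dagger H_k(x_k^*-\mathbb Ex_k^*)-\bar\Upsilon_k^\dagger\bar H_k\,\mathbb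 Ex_k^*-\bar\Upsilon_k^\dagger\zeta_k ,$$ where $x^*$ is the state of the closed-loop system, i.e. (1) with $u=u^*$ and $x_l^*=\xi$. 4. In particular, if $b,\sigma,g,\bar g,q,\bar q,\rho,\bar\rho$ are all zero, then $\eta\equiv0$, $\zeta\equiv0$ and $u_k^*=-\Upsilon_k^\dagger H_k(x_k^*-\mathbb Ex_k^*)-\bar\Upsilon_k^\dagger\bar H_k\,\mathbb Ex_k^*$. -/

import Mathlib

open MeasureTheory

noncomputable section

namespace MFLQ

/-! ### Moore-Penrose pseudo-inverse of a real square matrix -/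

/-- The four Penrose equations: `X` is a Moore-Penrose pseudo-inverse of `M`. -/
structure IsMoorePenrose {m : ℕ} (M X : Matrix (Fin m) (Fin m) ℝ) : Prop where
  mul_mul_self : M * X * M = M
  mul_mul_inv : X * M * X = X
  symm_left : (M * X).transpose = M * X
  symm_right : (X * M).transpose = X * M

theorem isMoorePenrose_unique {m : ℕ} {M X Y : Matrix (Fin m) (Fin m) ℝ}
    (hX : IsMoorePenrose M X) (hY : IsMoorePenrose M Y) : X = Y := by
  have h1 : M * X = M * Y := by
    calc M * X = (M * X).transpose := hX.symm_left.symm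
      _ = ((M * Y) * (M * X)).transpose := by
          rw [← Matrix.mul_assoc, hY.mul_mul_self]
      _ = (M * X) * (M * Y) := by
          rw [Matrix.transpose_mul, hX.symm_left, hY.symm_left]
      _ = M * Y := by rw [← Matrix.mul_assoc, hX.mul_mul_self]
  have h2 : X * M = Y * M := by
    calc X * M = (X * M).transpose := hX.symm_right.symm
      _ = ((X * M) * (Y * M)).transpose := by
          rw [Matrix.mul_assoc X M, ← Matrix.mul_assoc M Y, hY.mul_mul_self]
      _ = (Y * M) * (X * M) := by
          rw [Matrix.transpose_mul, hX.symm_right, hY.symm_right]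
      _ = Y * M := by
          rw [Matrix.mul_assoc Y M, ← Matrix.mul_assoc M X, hX.mul_mul_self]
  calc X = X * M * X := hX.mul_mul_inv.symm
    _ = Y * (M * X) := by rw [h2, Matrix.mul_assoc]
    _ = Y := by rw [h1, ← Matrix.mul_assoc, hY.mul_mul_inv]

theorem exists_isMoorePenrose {m : ℕ} (M : Matrix (Fin m) (Fin m) ℝ) :
    ∃ X, IsMoorePenrose M X := by
  obtain ⟨Y, hYs, hYH, hHYH, hYHY⟩ : ∃ Y : Matrix (Fin m) (Fin m) ℝ,
      Y.transpose = Y ∧ Y * (M.transpose * M) = (M.transpose * M) * Y ∧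
      (M.transpose * M) * Y * (M.transpose * M) = M.transpose * M ∧
      Y * (M.transpose * M) * Y = Y := by
    have hH : (M.transpose * M).IsHermitian := by
      simpa using Matrix.isHermitian_conjTranspose_mul_self M
    obtain ⟨U, d, hU, hd⟩ : ∃ (U : Matrix (Fin m) (Fin m) ℝ) (d : Fin m → ℝ),
        U.transpose * U = 1 ∧
          M.transpose * M = U * Matrix.diagonal d * U.transpose := by
      refine ⟨hH.eigenvectorUnitary, hH.eigenvalues, ?_, ?_⟩
      · simpa [Matrix.star_eq_conjTranspose] using
          Unitary.coe_star_mul_self hH.eigenvectorUnitary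
      · have := hH.spectral_theorem
        rw [Unitary.conjStarAlgAut_apply] at this
        simpa [Matrix.star_eq_conjTranspose, Function.comp_def] using this
    have key : ∀ a b : Fin m → ℝ,
        (U * Matrix.diagonal a * U.transpose) * (U * Matrix.diagonal b * U.transpose)
          = U * Matrix.diagonal (fun i => a i * b i) * U.transpose := by
      intro a b
      calc _ = U * Matrix.diagonal a * (U.transpose * U) * Matrix.diagonal b * U.transpose := by
            simp only [Matrix.mul_assoc]
        _ = _ := by
            rw [hU, Matrix.mul_one, Matrix.mul_assoc U, Matrix.diagonal_mul_diagonal]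
    refine ⟨U * Matrix.diagonal (fun i => (d i)⁻¹) * U.transpose, ?_, ?_, ?_, ?_⟩
    · simp [Matrix.transpose_mul, Matrix.mul_assoc]
    · rw [hd, key, key]; simp only [mul_comm]
    · rw [hd, key, key]
      congr 3; funext i; exact mul_inv_mul_cancel (d i)
    · rw [hd, key, key]
      congr 3; funext i
      by_cases h : d i = 0 <;> simp [h]
  have hproj : M * (Y * (M.transpose * M)) = M := by
    have h0 : M * (Y * (M.transpose * M)) - M = 0 := by
      rw [← Matrix.conjTranspose_mul_self_eq_zero]
      have hz : M.transpose * (M * (Y * (M.transpose * M)) - M) = 0 := by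
        rw [Matrix.mul_sub, sub_eq_zero, ← Matrix.mul_assoc, ← Matrix.mul_assoc]
        exact hHYH
      have ht : (M * (Y * (M.transpose * M)) - M).conjTranspose
          = ((Y * (M.transpose * M)).transpose - 1) * M.transpose := by
        rw [Matrix.conjTranspose_eq_transpose_of_trivial, Matrix.transpose_sub,
          Matrix.transpose_mul M, Matrix.sub_mul, Matrix.one_mul]
      rw [ht, Matrix.mul_assoc, hz, Matrix.mul_zero]
    exact sub_eq_zero.mp h0
  refine ⟨Y * M.transpose, ?_, ?_, ?_, ?_⟩
  · rw [Matrix.mul_assoc, Matrix.mul_assoc]; exact hproj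
  · calc Y * M.transpose * M * (Y * M.transpose)
        = (Y * (M.transpose * M) * Y) * M.transpose := by simp only [Matrix.mul_assoc]
      _ = Y * M.transpose := by rw [hYHY]
  · simp only [Matrix.transpose_mul, Matrix.transpose_transpose, hYs, Matrix.mul_assoc]
  · rw [Matrix.mul_assoc, Matrix.transpose_mul, hYs, hYH, Matrix.transpose_mul,
      Matrix.transpose_transpose]

/-- The Moore-Penrose pseudo-inverse `M†`. -/
def mpInv {m : ℕ} (M : Matrix (Fin m) (Fin m) ℝ) : Matrix (Fin m) (Fin m) ℝ :=
  Classical.choose (exists_isMoorePenrose M)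

theorem mpInv_spec {m : ℕ} (M : Matrix (Fin m) (Fin m) ℝ) : IsMoorePenrose M (mpInv M) :=
  Classical.choose_spec (exists_isMoorePenrose M)

/-! ### Data of the problem

Vectors are functions `Fin n → ℝ` and inner products are dot products `⬝ᵥ`, so that `u ⬝ᵥ u`
is the squared Euclidean norm; a name ending in `bar` denotes the barred (mean-field) object.
-/

/-- The deterministic coefficients of the state equation and the (symmetric, possibly indefinite)
quadratic weights of the cost. The cross weights `S k`, `Sbar k` are `n × m`. -/
structure System (n m : ℕ) where
  A : ℕ → Matrix (Fin n) (Fin n) ℝ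
  Abar : ℕ → Matrix (Fin n) (Fin n) ℝ
  B : ℕ → Matrix (Fin n) (Fin m) ℝ
  Bbar : ℕ → Matrix (Fin n) (Fin m) ℝ
  C : ℕ → Matrix (Fin n) (Fin n) ℝ
  Cbar : ℕ → Matrix (Fin n) (Fin n) ℝ
  D : ℕ → Matrix (Fin n) (Fin m) ℝ
  Dbar : ℕ → Matrix (Fin n) (Fin m) ℝ
  b : ℕ → Fin n → ℝ
  σ : ℕ → Fin n → ℝ
  Q : ℕ → Matrix (Fin n) (Fin n) ℝ
  Qbar : ℕ → Matrix (Fin n) (Fin n) ℝ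
  S : ℕ → Matrix (Fin n) (Fin m) ℝ
  Sbar : ℕ → Matrix (Fin n) (Fin m) ℝ
  R : ℕ → Matrix (Fin m) (Fin m) ℝ
  Rbar : ℕ → Matrix (Fin m) (Fin m) ℝ
  G : Matrix (Fin n) (Fin n) ℝ
  Gbar : Matrix (Fin n) (Fin n) ℝ
  Q_symm : ∀ k, (Q k).IsSymm
  Qbar_symm : ∀ k, (Qbar k).IsSymm
  R_symm : ∀ k, (R k).IsSymm
  Rbar_symm : ∀ k, (Rbar k).IsSymm
  G_symm : G.IsSymm
  Gbar_symm : Gbar.IsSymm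

/-- The same system with `b = 0` and `σ = 0`. -/
def System.homogeneous {n m : ℕ} (sys : System n m) : System n m :=
  { sys with b := fun _ => 0, σ := fun _ => 0 }

/-- The linear weights of the cost: random vectors `g`, `gbar` and random processes
`q`, `qbar`, `ρ`, `ρbar`. -/
structure RandomWeights (Ω : Type*) (n m : ℕ) where
  g : Ω → Fin n → ℝ
  gbar : Ω → Fin n → ℝ
  q : ℕ → Ω → Fin n → ℝ
  qbar : ℕ → Ω → Fin n → ℝ
  ρ : ℕ → Ω → Fin m → ℝ
  ρbar : ℕ → Ω → Fin m → ℝ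

/-- Square integrability of the random linear weights on the horizon `0, …, N`. -/
structure RandomWeights.SquareIntegrable {Ω : Type*} [MeasurableSpace Ω] {n m : ℕ}
    (w : RandomWeights Ω n m) (μ : Measure Ω) (N : ℕ) : Prop where
  g : MemLp w.g 2 μ
  gbar : MemLp w.gbar 2 μ
  q : ∀ k < N, MemLp (w.q k) 2 μ
  qbar : ∀ k < N, MemLp (w.qbar k) 2 μ
  ρ : ∀ k < N, MemLp (w.ρ k) 2 μ
  ρbar : ∀ k < N, MemLp (w.ρbar k) 2 μ

/-- Deterministic linear weights. -/
structure Weights (n m : ℕ) where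
  g : Fin n → ℝ
  gbar : Fin n → ℝ
  q : ℕ → Fin n → ℝ
  qbar : ℕ → Fin n → ℝ
  ρ : ℕ → Fin m → ℝ
  ρbar : ℕ → Fin m → ℝ

/-- Deterministic weights regarded as (constant) random weights. -/
def Weights.toRandom {n m : ℕ} (d : Weights n m) (Ω : Type*) : RandomWeights Ω n m where
  g := fun _ => d.g
  gbar := fun _ => d.gbar
  q := fun k _ => d.q k
  qbar := fun k _ => d.qbar k
  ρ := fun k _ => d.ρ k
  ρbar := fun k _ => d.ρbar k

/-- All linear weights vanish. -/
def Weights.zero (n m : ℕ) : Weights n m := ⟨0, 0, 0, 0, 0, 0⟩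

/-! ### Information, initial states, controls -/

/-- The information available when the control at time `k` is chosen:
the `σ`-algebra generated by `ξ` and by the noises `W l, …, W (k-1)`. -/
@[reducible] def history {Ω : Type*} {n : ℕ} (W : ℕ → Ω → ℝ) (l : ℕ) (ξ : Ω → Fin n → ℝ) (k : ℕ) :
    MeasurableSpace Ω :=
  MeasurableSpace.comap ξ inferInstance ⊔
    ⨆ j ∈ Set.Ico l k, MeasurableSpace.comap (W j) inferInstance

/-- `ξ` is an admissible initial state at time `l`: it is square integrable, and
`W l, …, W (N-1)` is a martingale difference sequence with unit conditional variances relative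
to the information generated by `ξ` and the past noises. -/
structure IsInitialState {Ω : Type*} [MeasurableSpace Ω] {n : ℕ} (μ : Measure Ω) (N : ℕ)
    (W : ℕ → Ω → ℝ) (l : ℕ) (ξ : Ω → Fin n → ℝ) : Prop where
  measurable : Measurable ξ
  memLp : MemLp ξ 2 μ
  mean_zero : ∀ k, l ≤ k → k < N → μ[W k|history W l ξ k] =ᵐ[μ] fun _ => 0
  unit_variance : ∀ k, l ≤ k → k < N →
    μ[fun ω => (W k ω) ^ 2|history W l ξ k] =ᵐ[μ] fun _ => 1

/-- The admissible controls `(u l, …, u (N-1))` for the initial pair `(l, ξ)`: square integrable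
and non-anticipative. (The values of `u` at other times play no role.) -/
def Admissible {Ω : Type*} [MeasurableSpace Ω] {n m : ℕ} (μ : Measure Ω) (N : ℕ)
    (W : ℕ → Ω → ℝ) (l : ℕ) (ξ : Ω → Fin n → ℝ) (u : ℕ → Ω → Fin m → ℝ) : Prop :=
  ∀ k, l ≤ k → k < N → Measurable[history W l ξ k] (u k) ∧ MemLp (u k) 2 μ

/-! ### State equation and cost -/

/-- The state `x k`, `k ≥ l`, started from `x l = ξ` and driven by the control `u`.
(For `k < l` the value is `ξ`, and it is never used.) -/
def state {Ω : Type*} [MeasurableSpace Ω] {n m : ℕ} (sys : System n m) (μ : Measure Ω)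
    (W : ℕ → Ω → ℝ) (l : ℕ) (ξ : Ω → Fin n → ℝ) (u : ℕ → Ω → Fin m → ℝ) :
    ℕ → Ω → Fin n → ℝ
  | 0 => ξ
  | k + 1 =>
    if k + 1 ≤ l then ξ
    else fun ω =>
      (sys.A k).mulVec (state sys μ W l ξ u k ω)
        + (sys.Abar k).mulVec (∫ ω', state sys μ W l ξ u k ω' ∂μ)
        + (sys.B k).mulVec (u k ω) + (sys.Bbar k).mulVec (∫ ω', u k ω' ∂μ) + sys.b k
        + W k ω •
          ((sys.C k).mulVec (state sys μ W l ξ u k ω)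
            + (sys.Cbar k).mulVec (∫ ω', state sys μ W l ξ u k ω' ∂μ)
            + (sys.D k).mulVec (u k ω) + (sys.Dbar k).mulVec (∫ ω', u k ω' ∂μ) + sys.σ k)

/-- The cost functional `J(l, ξ; u)`. -/
def cost {Ω : Type*} [MeasurableSpace Ω] {n m : ℕ} (sys : System n m)
    (w : RandomWeights Ω n m) (μ : Measure Ω) (N : ℕ) (W : ℕ → Ω → ℝ) (l : ℕ)
    (ξ : Ω → Fin n → ℝ) (u : ℕ → Ω → Fin m → ℝ) : ℝ :=
  let x := state sys μ W l ξ u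
  let Ex : ℕ → Fin n → ℝ := fun k => ∫ ω, x k ω ∂μ
  let Eu : ℕ → Fin m → ℝ := fun k => ∫ ω, u k ω ∂μ
  ∫ ω,
    (x N ω ⬝ᵥ sys.G.mulVec (x N ω) + 2 * (w.g ω ⬝ᵥ x N ω)
      + Ex N ⬝ᵥ sys.Gbar.mulVec (Ex N) + 2 * (w.gbar ω ⬝ᵥ Ex N)
      + ∑ k ∈ Finset.Ico l N,
        (x k ω ⬝ᵥ (sys.Q k).mulVec (x k ω) + 2 * (x k ω ⬝ᵥ (sys.S k).mulVec (u k ω))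
          + u k ω ⬝ᵥ (sys.R k).mulVec (u k ω)
          + 2 * (w.q k ω ⬝ᵥ x k ω + w.ρ k ω ⬝ᵥ u k ω)
          + Ex k ⬝ᵥ (sys.Qbar k).mulVec (Ex k) + 2 * (Ex k ⬝ᵥ (sys.Sbar k).mulVec (Eu k))
          + Eu k ⬝ᵥ (sys.Rbar k).mulVec (Eu k)
          + 2 * (w.qbar k ω ⬝ᵥ Ex k + w.ρbar k ω ⬝ᵥ Eu k))) ∂μ

/-- The cost `J⁰(l, x₀; u)` of the homogeneous problem: `b`, `σ` and all linear weights
are zero. -/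
def homCost {Ω : Type*} [MeasurableSpace Ω] {n m : ℕ} (sys : System n m) (μ : Measure Ω)
    (N : ℕ) (W : ℕ → Ω → ℝ) (l : ℕ) (x₀ : Ω → Fin n → ℝ) (u : ℕ → Ω → Fin m → ℝ) : ℝ :=
  cost sys.homogeneous ((Weights.zero n m).toRandom Ω) μ N W l x₀ u

/-- Uniform convexity at time `l`: for some `α > 0`, `J⁰(l, 0; u) ≥ α 𝔼 ∑ |u k|²` for all
admissible controls `u` (admissible with respect to the information generated by `ξ`
and the noise). -/
def UniformlyConvexAt {Ω : Type*} [MeasurableSpace Ω] {n m : ℕ} (sys : System n m)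
    (μ : Measure Ω) (N : ℕ) (W : ℕ → Ω → ℝ) (l : ℕ) (ξ : Ω → Fin n → ℝ) : Prop :=
  ∃ α : ℝ, 0 < α ∧ ∀ u : ℕ → Ω → Fin m → ℝ, Admissible μ N W l ξ u →
    α * ∫ ω, ∑ k ∈ Finset.Ico l N, u k ω ⬝ᵥ u k ω ∂μ ≤ homCost sys μ N W l (fun _ => 0) u

/-- `u` is an open-loop optimal control at the initial pair `(l, ξ)`. -/
def IsOpenLoopOptimal {Ω : Type*} [MeasurableSpace Ω] {n m : ℕ} (sys : System n m)
    (w : RandomWeights Ω n m) (μ : Measure Ω) (N : ℕ) (W : ℕ → Ω → ℝ) (l : ℕ)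
    (ξ : Ω → Fin n → ℝ) (u : ℕ → Ω → Fin m → ℝ) : Prop :=
  Admissible μ N W l ξ u ∧
    ∀ v : ℕ → Ω → Fin m → ℝ, Admissible μ N W l ξ v →
      cost sys w μ N W l ξ u ≤ cost sys w μ N W l ξ v

/-- `u` is the unique open-loop optimal control at `(l, ξ)`, up to almost sure equality. -/
def IsUniqueOpenLoopOptimal {Ω : Type*} [MeasurableSpace Ω] {n m : ℕ} (sys : System n m)
    (w : RandomWeights Ω n m) (μ : Measure Ω) (N : ℕ) (W : ℕ → Ω → ℝ) (l : ℕ)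
    (ξ : Ω → Fin n → ℝ) (u : ℕ → Ω → Fin m → ℝ) : Prop :=
  IsOpenLoopOptimal sys w μ N W l ξ u ∧
    ∀ v : ℕ → Ω → Fin m → ℝ, IsOpenLoopOptimal sys w μ N W l ξ v →
      ∀ k, l ≤ k → k < N → v k =ᵐ[μ] u k

/-! ### Riccati equations and the linear recursive equation -/

section Riccati

variable {n m : ℕ} (sys : System n m) (d : Weights n m)
  (P Pi : ℕ → Matrix (Fin n) (Fin n) ℝ) (η : ℕ → Fin n → ℝ)

/-- `Υ k = R + B' P B + D' P D`, with `P` taken at time `k + 1`. -/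
def Ups (k : ℕ) : Matrix (Fin m) (Fin m) ℝ :=
  sys.R k + (sys.B k).transpose * P (k + 1) * sys.B k
    + (sys.D k).transpose * P (k + 1) * sys.D k

/-- `B' P A + D' P C + S'`, with `P` taken at time `k + 1`. -/
def Hmat (k : ℕ) : Matrix (Fin m) (Fin n) ℝ :=
  (sys.B k).transpose * P (k + 1) * sys.A k + (sys.D k).transpose * P (k + 1) * sys.C k
    + (sys.S k).transpose

/-- `R + R̄ + (B + B̄)' Π (B + B̄) + (D + D̄)' P (D + D̄)`, with `P`, `Π` taken at time `k + 1`. -/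
def UpsBar (k : ℕ) : Matrix (Fin m) (Fin m) ℝ :=
  sys.R k + sys.Rbar k
    + (sys.B k + sys.Bbar k).transpose * Pi (k + 1) * (sys.B k + sys.Bbar k)
    + (sys.D k + sys.Dbar k).transpose * P (k + 1) * (sys.D k + sys.Dbar k)

/-- `(B + B̄)' Π (A + Ā) + (D + D̄)' P (C + C̄) + S' + S̄'`, with `P`, `Π` taken at `k + 1`. -/
def HBar (k : ℕ) : Matrix (Fin m) (Fin n) ℝ :=
  (sys.B k + sys.Bbar k).transpose * Pi (k + 1) * (sys.A k + sys.Abar k)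
    + (sys.D k + sys.Dbar k).transpose * P (k + 1) * (sys.C k + sys.Cbar k)
    + (sys.S k).transpose + (sys.Sbar k).transpose

/-- `(P, Π)` solves the generalized Riccati equations on `{0, …, N}`. -/
structure IsGRESolution (N : ℕ) : Prop where
  terminal_P : P N = sys.G
  terminal_Pi : Pi N = sys.G + sys.Gbar
  step_P : ∀ k < N, P k =
    sys.Q k + (sys.A k).transpose * P (k + 1) * sys.A k
      + (sys.C k).transpose * P (k + 1) * sys.C k
      - (Hmat sys P k).transpose * mpInv (Ups sys P k) * Hmat sys P k
  step_Pi : ∀ k < N, Pi k =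
    sys.Q k + sys.Qbar k
      + (sys.A k + sys.Abar k).transpose * Pi (k + 1) * (sys.A k + sys.Abar k)
      + (sys.C k + sys.Cbar k).transpose * P (k + 1) * (sys.C k + sys.Cbar k)
      - (HBar sys P Pi k).transpose * mpInv (UpsBar sys P Pi k) * HBar sys P Pi k

/-- A strongly regular solution of the generalized Riccati equations: for some `α > 0`,
`Υ k ≥ α I` and `Ῡ k ≥ α I` for all `k < N`. -/
def IsStronglyRegular (N : ℕ) : Prop :=
  IsGRESolution sys P Pi N ∧
    ∃ α : ℝ, 0 < α ∧ ∀ k < N,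
      (Ups sys P k - α • (1 : Matrix (Fin m) (Fin m) ℝ)).PosSemidef ∧
      (UpsBar sys P Pi k - α • (1 : Matrix (Fin m) (Fin m) ℝ)).PosSemidef

/-- `ζ k = (D + D̄)' P σ + (B + B̄)' (Π b + η) + ρ + ρ̄`, with `P`, `Π`, `η` taken at `k + 1`. -/
def zeta (k : ℕ) : Fin m → ℝ :=
  (sys.D k + sys.Dbar k).transpose.mulVec ((P (k + 1)).mulVec (sys.σ k))
    + (sys.B k + sys.Bbar k).transpose.mulVec ((Pi (k + 1)).mulVec (sys.b k) + η (k + 1))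
    + d.ρ k + d.ρbar k

/-- `η` solves the linear recursive equation on `{0, …, N}`. -/
structure IsLRESolution (N : ℕ) : Prop where
  terminal : η N = d.g + d.gbar
  step : ∀ k < N, η k =
    (sys.C k + sys.Cbar k).transpose.mulVec ((P (k + 1)).mulVec (sys.σ k))
      + (sys.A k + sys.Abar k).transpose.mulVec ((Pi (k + 1)).mulVec (sys.b k) + η (k + 1))
      - (HBar sys P Pi k).transpose.mulVec
          ((mpInv (UpsBar sys P Pi k)).mulVec (zeta sys d P Pi η k))
      + d.q k + d.qbar k

/-- The feedback value
`- Υ† (B'PA + D'PC + S') (x - 𝔼x) - Ῡ† [(B+B̄)'Π(A+Ā) + (D+D̄)'P(C+C̄) + S' + S̄'] 𝔼x`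
at time `k`, where `x` is the current state and `Ex` its mean. -/
def linearFeedback (k : ℕ) (x Ex : Fin n → ℝ) : Fin m → ℝ :=
  -(mpInv (Ups sys P k)).mulVec ((Hmat sys P k).mulVec (x - Ex))
    - (mpInv (UpsBar sys P Pi k)).mulVec ((HBar sys P Pi k).mulVec Ex)

end Riccati

end MFLQ

end

namespace MFLQ

open Matrix

/-! ### Linear algebra -/

/-! The proof is a verification argument: completing the square backward in time turns the cost into
a constant plus nonnegative penalties, with no appeal to abstract minimisation in a Hilbert space.

Every state splits into its mean and its centred part. In one step the mean evolves
deterministically, while the mean of the diffusion coefficient multiplies the noise and so lands in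
the centred part of the next state. This is why `Π` acts on mean drifts but `P` acts on all
diffusion terms, the mean one included. Since the noise has conditional mean zero and conditional
variance one, the second moment of `f + Z g` is the sum of those of `f` and `g`
(`IsUnitNoise.integral_quadratic`). Completing the square separately in the centred control and in
its mean reproduces the two Riccati equations (`valueFn_nextState_add_runCost_eq`). Summing over
time (`AdjointFamily.tail_cost_eq`) gives: cost = value at the initial state + sum of `excess` terms
+ terms free of the control.

Random linear weights are carried backward by an adjoint process, obtained by projecting with
conditional expectations (`IsUnitNoise.exists_isAdjointStep`). For deterministic weights the process
reduces to `η`. If all `Υ` and `Ῡ` are positive definite, every excess is nonnegative and vanishes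
exactly for the feedback law, which is therefore the unique optimal control
(`AdjointFamily.isUniqueOpenLoopOptimal`).

It remains to derive strong regularity from uniform convexity, by backward induction on time
(`IsGRESolution.isStronglyRegular_of_convex`). With positivity known after time `k`, take a control
that is zero before `k`, equals `ψ v` at `k`, and is the optimal feedback afterwards. For the
homogeneous problem started at zero its cost is `Var ψ · ⟨Υ v, v⟩ + (𝔼 ψ)² · ⟨Ῡ v, v⟩`
(`exists_control_cost_eq`). A constant `ψ` bounds `Ῡ` below, and a nontrivial centred `ψ` bounds
`Υ`. Non-constancy of the initial state supplies such a `ψ` already at time `0`, where a trivial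
`σ`-algebra would leave `Υ` untested. -/

theorem mpInv_isSymm {m : ℕ} {M : Matrix (Fin m) (Fin m) ℝ} (h : M.IsSymm) :
    (mpInv M).IsSymm := by
  have hX := mpInv_spec M
  -- For symmetric `M`, transposition preserves the first two Penrose equations and exchanges the
  -- two symmetry conditions, so uniqueness identifies the transpose with the pseudo-inverse itself.
  refine isMoorePenrose_unique (M := M) ⟨?_, ?_, ?_, ?_⟩ hX
  · have := congrArg transpose hX.mul_mul_self
    simpa only [transpose_mul, h.eq, Matrix.mul_assoc] using this
  · have := congrArg transpose hX.mul_mul_inv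
    simpa only [transpose_mul, h.eq, Matrix.mul_assoc] using this
  · have := hX.symm_right
    rw [transpose_mul, h.eq] at this
    rw [transpose_mul, transpose_transpose, h.eq, this]
  · have := hX.symm_left
    rw [transpose_mul, h.eq] at this
    rw [transpose_mul, transpose_transpose, h.eq, this]

theorem mul_mpInv_of_posDef {m : ℕ} {M : Matrix (Fin m) (Fin m) ℝ} (h : M.PosDef) :
    M * mpInv M = 1 := by
  have hu := h.isUnit
  have := (mpInv_spec M).mul_mul_self
  exact hu.mul_right_cancel (by rw [this, Matrix.one_mul])

theorem dotProduct_mulVec_comm {a b : ℕ} (M : Matrix (Fin a) (Fin b) ℝ) (x : Fin a → ℝ)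
    (y : Fin b → ℝ) : x ⬝ᵥ M *ᵥ y = y ⬝ᵥ Mᵀ *ᵥ x := by
  rw [dotProduct_mulVec, mulVec_transpose, dotProduct_comm]

theorem mulVec_dotProduct_mulVec {a b c d : ℕ} (A : Matrix (Fin a) (Fin b) ℝ)
    (M : Matrix (Fin a) (Fin c) ℝ) (B : Matrix (Fin c) (Fin d) ℝ) (x : Fin b → ℝ)
    (y : Fin d → ℝ) : (A *ᵥ x) ⬝ᵥ M *ᵥ (B *ᵥ y) = x ⬝ᵥ (Aᵀ * M * B) *ᵥ y := by
  rw [mulVec_mulVec, ← mulVec_mulVec, ← mulVec_mulVec, Matrix.mulVec_mulVec,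
    dotProduct_comm, dotProduct_mulVec_comm, mulVec_mulVec]
  simp only [mulVec_mulVec, Matrix.mul_assoc]

/-- The one-step quadratic cost, written as a quadratic form in the state and the control. -/
theorem one_step_quadratic {n m : ℕ} {P₁ P₂ Q : Matrix (Fin n) (Fin n) ℝ}
    (A C : Matrix (Fin n) (Fin n) ℝ) (B D S : Matrix (Fin n) (Fin m) ℝ)
    (R : Matrix (Fin m) (Fin m) ℝ) (h₁ : P₁.IsSymm) (h₂ : P₂.IsSymm)
    (x : Fin n → ℝ) (u : Fin m → ℝ) :
    (A *ᵥ x + B *ᵥ u) ⬝ᵥ P₁ *ᵥ (A *ᵥ x + B *ᵥ u) + (C *ᵥ x + D *ᵥ u) ⬝ᵥ P₂ *ᵥ (C *ᵥ x + D *ᵥ u)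
        + x ⬝ᵥ Q *ᵥ x + 2 * (x ⬝ᵥ S *ᵥ u) + u ⬝ᵥ R *ᵥ u
      = x ⬝ᵥ (Q + Aᵀ * P₁ * A + Cᵀ * P₂ * C) *ᵥ x
        + 2 * (u ⬝ᵥ (Bᵀ * P₁ * A + Dᵀ * P₂ * C + Sᵀ) *ᵥ x)
        + u ⬝ᵥ (R + Bᵀ * P₁ * B + Dᵀ * P₂ * D) *ᵥ u := by
  have e₁ : x ⬝ᵥ (Aᵀ * P₁ * B) *ᵥ u = u ⬝ᵥ (Bᵀ * P₁ * A) *ᵥ x := by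
    rw [dotProduct_mulVec_comm]; simp [transpose_mul, Matrix.mul_assoc, h₁.eq]
  have e₂ : x ⬝ᵥ (Cᵀ * P₂ * D) *ᵥ u = u ⬝ᵥ (Dᵀ * P₂ * C) *ᵥ x := by
    rw [dotProduct_mulVec_comm]; simp [transpose_mul, Matrix.mul_assoc, h₂.eq]
  have e₃ : x ⬝ᵥ S *ᵥ u = u ⬝ᵥ Sᵀ *ᵥ x := dotProduct_mulVec_comm _ _ _
  simp only [mulVec_add, add_dotProduct, dotProduct_add, mulVec_dotProduct_mulVec, add_mulVec,
    e₁, e₂, e₃]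
  ring

/-- Completion of the square in the control. -/
theorem complete_square {n m : ℕ} {Υ K : Matrix (Fin m) (Fin m) ℝ} (hΥ : Υ.IsSymm) (hK : K.IsSymm)
    (hΥK : Υ * K = 1) (𝒬 : Matrix (Fin n) (Fin n) ℝ) (H : Matrix (Fin m) (Fin n) ℝ)
    (h x : Fin n → ℝ) (r u : Fin m → ℝ) :
    x ⬝ᵥ 𝒬 *ᵥ x + 2 * (u ⬝ᵥ H *ᵥ x) + u ⬝ᵥ Υ *ᵥ u + 2 * (h ⬝ᵥ x) + 2 * (r ⬝ᵥ u)
      = x ⬝ᵥ (𝒬 - Hᵀ * K * H) *ᵥ x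
        + (u + K *ᵥ (H *ᵥ x + r)) ⬝ᵥ Υ *ᵥ (u + K *ᵥ (H *ᵥ x + r))
        + 2 * ((h - Hᵀ *ᵥ (K *ᵥ r)) ⬝ᵥ x) - r ⬝ᵥ K *ᵥ r := by
  set y := H *ᵥ x + r with hy
  have e₀ : Υ *ᵥ (K *ᵥ y) = y := by rw [mulVec_mulVec, hΥK, one_mulVec]
  have e₁ : (K *ᵥ y) ⬝ᵥ Υ *ᵥ u = u ⬝ᵥ y := by
    rw [dotProduct_mulVec_comm, hΥ.eq, e₀]
  have e₂ : (Hᵀ *ᵥ (K *ᵥ r)) ⬝ᵥ x = r ⬝ᵥ K *ᵥ (H *ᵥ x) := by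
    rw [dotProduct_comm, ← dotProduct_mulVec_comm, dotProduct_comm, dotProduct_mulVec_comm, hK.eq]
  have e₃ : x ⬝ᵥ (Hᵀ * K * H) *ᵥ x = (H *ᵥ x) ⬝ᵥ K *ᵥ (H *ᵥ x) :=
    (mulVec_dotProduct_mulVec _ _ _ _ _).symm
  have e₄ : (H *ᵥ x) ⬝ᵥ K *ᵥ r = r ⬝ᵥ K *ᵥ (H *ᵥ x) := by
    rw [dotProduct_mulVec_comm, hK.eq]
  have e₅ : (K *ᵥ y) ⬝ᵥ y = y ⬝ᵥ K *ᵥ y := dotProduct_comm _ _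
  simp only [mulVec_add Υ, add_dotProduct, dotProduct_add, e₀, e₁, e₅, sub_mulVec, sub_dotProduct,
    dotProduct_sub, e₂, e₃]
  rw [hy]
  simp only [mulVec_add, add_dotProduct, dotProduct_add, e₄, dotProduct_comm r u]
  ring

/-- Backward recursion from a terminal value at time `N`. -/
theorem exists_backward {α : Type*} (N : ℕ) (p : α → Prop) (R : ℕ → α → α → Prop) (a : α)
    (ha : p a) (h : ∀ k < N, ∀ x, p x → ∃ y, p y ∧ R k x y) :
    ∃ f : ℕ → α, f N = a ∧ (∀ k ≤ N, p (f k)) ∧ ∀ k < N, R k (f (k + 1)) (f k) := by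
  induction N generalizing a with
  | zero => exact ⟨fun _ => a, rfl, fun _ _ => ha, by simp⟩
  | succ N ih =>
    obtain ⟨y, hy, hR⟩ := h N (Nat.lt_succ_self N) a ha
    obtain ⟨f, hf, hp, hs⟩ := ih y hy fun k hk => h k (Nat.lt_succ_of_lt hk)
    -- The induction peels off the last step: the solution on `{0, …, N}` ending at `y` is extended
    -- by the prescribed terminal value.
    refine ⟨Function.update f (N + 1) a, by simp, fun k hk => ?_, fun k hk => ?_⟩
    · rcases Nat.lt_or_ge N k with h' | h'
      · obtain rfl : k = N + 1 := by omega
        simpa using ha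
      · rw [Function.update_of_ne (by omega)]; exact hp k h'
    · rcases Nat.lt_or_ge k N with h' | h'
      · rw [Function.update_of_ne (by omega), Function.update_of_ne (by omega)]; exact hs k h'
      · obtain rfl : k = N := by omega
        rw [Function.update_self, Function.update_of_ne (by omega), hf]; exact hR

/-! ### Riccati equations -/

section Riccati

variable {n m : ℕ} (sys : System n m)

/-- Because the pseudo-inverse is defined for every matrix, the equations are an explicit backward
recursion and can be solved without any definiteness; regularity is proved afterwards for this
solution. -/
theorem exists_isGRESolution (N : ℕ) :
    ∃ P Pi : ℕ → Matrix (Fin n) (Fin n) ℝ, IsGRESolution sys P Pi N := by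
  let M := Matrix (Fin n) (Fin n) ℝ
  obtain ⟨f, hN, -, hf⟩ := exists_backward (α := M × M) N (fun _ => True)
    -- The coefficient matrices read `P` and `Π` only at time `k + 1`, so constant sequences with
    -- the current values can stand in for them.
    (fun k x y => y = (
      sys.Q k + (sys.A k).transpose * x.1 * sys.A k
        + (sys.C k).transpose * x.1 * sys.C k
        - (Hmat sys (fun _ => x.1) k).transpose * mpInv (Ups sys (fun _ => x.1) k)
          * Hmat sys (fun _ => x.1) k,
      sys.Q k + sys.Qbar k
        + (sys.A k + sys.Abar k).transpose * x.2 * (sys.A k + sys.Abar k)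
        + (sys.C k + sys.Cbar k).transpose * x.1 * (sys.C k + sys.Cbar k)
        - (HBar sys (fun _ => x.1) (fun _ => x.2) k).transpose
          * mpInv (UpsBar sys (fun _ => x.1) (fun _ => x.2) k)
          * HBar sys (fun _ => x.1) (fun _ => x.2) k))
    (sys.G, sys.G + sys.Gbar) trivial (fun k _ x _ => ⟨_, trivial, rfl⟩)
  refine ⟨fun k => (f k).1, fun k => (f k).2, by simp [hN], by simp [hN], fun k hk => ?_,
    fun k hk => ?_⟩
  · exact congrArg Prod.fst (hf k hk)
  · exact congrArg Prod.snd (hf k hk)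

variable {sys} {P Pi P' Pi' : ℕ → Matrix (Fin n) (Fin n) ℝ} {N : ℕ}

/-- Each step is determined by the next one, so uniqueness needs no regularity; it holds only up to
time `N`, the values beyond being free. -/
theorem IsGRESolution.unique (h : IsGRESolution sys P Pi N) (h' : IsGRESolution sys P' Pi' N) :
    ∀ k ≤ N, P' k = P k ∧ Pi' k = Pi k := by
  intro k hk
  induction hk using Nat.decreasingInduction with
  | self => exact ⟨by rw [h.terminal_P, h'.terminal_P], by rw [h.terminal_Pi, h'.terminal_Pi]⟩
  | of_succ k hk ih =>
    obtain ⟨e₁, e₂⟩ := ih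
    constructor
    · rw [h.step_P k hk, h'.step_P k hk]; simp only [Hmat, Ups, e₁]
    · rw [h.step_Pi k hk, h'.step_Pi k hk]; simp only [HBar, UpsBar, e₁, e₂]

theorem isSymm_conj {a b : ℕ} {M : Matrix (Fin a) (Fin a) ℝ} (hM : M.IsSymm)
    (B : Matrix (Fin a) (Fin b) ℝ) : (Bᵀ * M * B).IsSymm := by
  simp [Matrix.IsSymm, transpose_mul, Matrix.mul_assoc, hM.eq]

theorem ups_isSymm {k : ℕ} (h : (P (k + 1)).IsSymm) : (Ups sys P k).IsSymm :=
  ((sys.R_symm k).add (isSymm_conj h _)).add (isSymm_conj h _)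

theorem upsBar_isSymm {k : ℕ} (h : (P (k + 1)).IsSymm) (h' : (Pi (k + 1)).IsSymm) :
    (UpsBar sys P Pi k).IsSymm :=
  (((sys.R_symm k).add (sys.Rbar_symm k)).add (isSymm_conj h' _)).add (isSymm_conj h _)

theorem IsGRESolution.isSymm (h : IsGRESolution sys P Pi N) :
    ∀ k ≤ N, (P k).IsSymm ∧ (Pi k).IsSymm := by
  intro k hk
  induction hk using Nat.decreasingInduction with
  | self =>
    rw [h.terminal_P, h.terminal_Pi]
    exact ⟨sys.G_symm, sys.G_symm.add sys.Gbar_symm⟩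
  | of_succ k hk ih =>
    obtain ⟨e₁, e₂⟩ := ih
    rw [h.step_P k hk, h.step_Pi k hk]
    exact ⟨(((sys.Q_symm k).add (isSymm_conj e₁ _)).add (isSymm_conj e₁ _)).sub
        (isSymm_conj (mpInv_isSymm (ups_isSymm e₁)) _),
      ((((sys.Q_symm k).add (sys.Qbar_symm k)).add (isSymm_conj e₂ _)).add
        (isSymm_conj e₁ _)).sub (isSymm_conj (mpInv_isSymm (upsBar_isSymm e₁ e₂)) _)⟩

theorem posDef_of_sub_smul_one {a : ℕ} {M : Matrix (Fin a) (Fin a) ℝ} {α : ℝ} (hα : 0 < α)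
    (h : (M - α • (1 : Matrix (Fin a) (Fin a) ℝ)).PosSemidef) : M.PosDef := by
  have h1 : (α • (1 : Matrix (Fin a) (Fin a) ℝ)).PosDef := Matrix.PosDef.one.smul hα
  simpa using h1.posSemidef_add h

theorem exists_isLRESolution (d : Weights n m) (P Pi : ℕ → Matrix (Fin n) (Fin n) ℝ) (N : ℕ) :
    ∃ η : ℕ → Fin n → ℝ, IsLRESolution sys d P Pi η N := by
  obtain ⟨f, hN, -, hf⟩ := exists_backward (α := Fin n → ℝ) N (fun _ => True)
    (fun k x y => y =
      (sys.C k + sys.Cbar k).transpose.mulVec ((P (k + 1)).mulVec (sys.σ k))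
      + (sys.A k + sys.Abar k).transpose.mulVec ((Pi (k + 1)).mulVec (sys.b k) + x)
      - (HBar sys P Pi k).transpose.mulVec
          ((mpInv (UpsBar sys P Pi k)).mulVec (zeta sys d P Pi (fun _ => x) k))
      + d.q k + d.qbar k)
    (d.g + d.gbar) trivial (fun k _ x _ => ⟨_, trivial, rfl⟩)
  exact ⟨f, hN, hf⟩

theorem IsLRESolution.unique {d : Weights n m} {η η' : ℕ → Fin n → ℝ}
    (h : IsLRESolution sys d P Pi η N) (h' : IsLRESolution sys d P Pi η' N) :
    ∀ k ≤ N, η' k = η k := by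
  intro k hk
  induction hk using Nat.decreasingInduction with
  | self => rw [h.terminal, h'.terminal]
  | of_succ k hk ih => rw [h.step k hk, h'.step k hk]; simp only [zeta, ih]

theorem IsLRESolution.eq_zero {η : ℕ → Fin n → ℝ} (hb : ∀ k < N, sys.b k = 0 ∧ sys.σ k = 0)
    (h : IsLRESolution sys (Weights.zero n m) P Pi η N) :
    (∀ k ≤ N, η k = 0) ∧ ∀ k < N, zeta sys (Weights.zero n m) P Pi η k = 0 := by
  have hη : ∀ k ≤ N, η k = 0 := by
    intro k hk
    induction hk using Nat.decreasingInduction with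
    | self => rw [h.terminal]; simp [Weights.zero]
    | of_succ k hk ih =>
      rw [h.step k hk]; simp [zeta, ih, Weights.zero, hb k hk]
  exact ⟨hη, fun k hk => by simp [zeta, hη (k + 1) hk, Weights.zero, hb k hk]⟩

end Riccati

/-! ### Conditional moments of the noise -/

section Noise

/-- `Z` has conditional mean zero and conditional variance one given `F`. -/
structure IsUnitNoise {Ω : Type*} {m0 : MeasurableSpace Ω} (μ : Measure Ω) (F : MeasurableSpace Ω)
    (Z : Ω → ℝ) : Prop where
  le : F ≤ m0
  measurable : Measurable[m0] Z
  mean_zero : μ[Z|F] =ᵐ[μ] fun _ => 0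
  unit_variance : μ[fun ω => (Z ω) ^ 2|F] =ᵐ[μ] fun _ => 1

variable {Ω : Type*} {F : MeasurableSpace Ω} [m0 : MeasurableSpace Ω] {μ : Measure Ω}
  [IsProbabilityMeasure μ] {Z : Ω → ℝ}

/-- Were `Z²` not integrable, its conditional expectation would be the default value `0`,
contradicting the value `1`. -/
theorem IsUnitNoise.integrable_sq (h : IsUnitNoise μ F Z) :
    Integrable (fun ω => (Z ω) ^ 2) μ := by
  by_contra hn
  have h1 := h.unit_variance
  rw [condExp_of_not_integrable hn] at h1
  obtain ⟨ω, hω⟩ := h1.exists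
  simp at hω

theorem IsUnitNoise.memLp (h : IsUnitNoise μ F Z) : MemLp Z 2 μ :=
  (memLp_two_iff_integrable_sq h.measurable.aestronglyMeasurable).2 h.integrable_sq

/-- Working with nonnegative functions avoids assuming that the product is integrable; the
integrability of `Z² g` is then read off from this identity. -/
theorem IsUnitNoise.lintegral_mul_sq (h : IsUnitNoise μ F Z) {f : Ω → ENNReal}
    (hf : Measurable[F] f) :
    ∫⁻ ω, ENNReal.ofReal ((Z ω) ^ 2) * f ω ∂μ = ∫⁻ ω, f ω ∂μ := by
  have hZ : Measurable fun ω => ENNReal.ofReal ((Z ω) ^ 2) :=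
    (h.measurable.pow_const 2).ennreal_ofReal
  -- Unit conditional variance says precisely that the measure with density `Z²` agrees with `μ` on
  -- `F`.
  have key : (μ.withDensity fun ω => ENNReal.ofReal ((Z ω) ^ 2)).trim h.le = μ.trim h.le := by
    refine @Measure.ext _ F _ _ fun s hs => ?_
    rw [trim_measurableSet_eq _ hs, trim_measurableSet_eq _ hs, withDensity_apply _ (h.le s hs),
      ← ofReal_integral_eq_lintegral_ofReal h.integrable_sq.integrableOn
        (Filter.Eventually.of_forall fun ω => sq_nonneg _),
      ← setIntegral_condExp h.le h.integrable_sq hs,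
      setIntegral_congr_ae (h.le s hs) (h.unit_variance.mono fun ω hω _ => hω)]
    simp
  have e := lintegral_withDensity_eq_lintegral_mul μ hZ (hf.mono h.le le_rfl)
  simp only [Pi.mul_apply] at e
  rw [← e, ← lintegral_trim h.le hf, key, lintegral_trim h.le hf]

theorem IsUnitNoise.integrable_sq_mul (h : IsUnitNoise μ F Z) {g : Ω → ℝ}
    (hg : Measurable[F] g) (hgi : Integrable g μ) :
    Integrable (fun ω => (Z ω) ^ 2 * g ω) μ := by
  have hgm : Measurable g := hg.mono h.le le_rfl
  refine ⟨((h.measurable.pow_const 2).mul hgm).aestronglyMeasurable, ?_⟩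
  have := h.lintegral_mul_sq (f := fun ω => ‖g ω‖ₑ) (measurable_enorm.comp hg)
  have h2 := hgi.2
  rw [HasFiniteIntegral] at h2 ⊢
  rw [← this] at h2
  convert h2 using 3 with ω
  rw [enorm_mul, Real.enorm_of_nonneg (sq_nonneg _)]

/-- Domination by `|g| + Z² |g|`, since `|Z| ≤ 1 + Z²`. No independence or boundedness is required,
and `g` need only be integrable. -/
theorem IsUnitNoise.integrable_mul (h : IsUnitNoise μ F Z) {g : Ω → ℝ}
    (hg : Measurable[F] g) (hgi : Integrable g μ) :
    Integrable (fun ω => Z ω * g ω) μ := by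
  have hgm : Measurable g := hg.mono h.le le_rfl
  refine (hgi.norm.add (h.integrable_sq_mul hg hgi).norm).mono
    (h.measurable.mul hgm).aestronglyMeasurable (Filter.Eventually.of_forall fun ω => ?_)
  simp only [Pi.add_apply, norm_mul, norm_pow, Real.norm_eq_abs]
  rw [abs_of_nonneg (add_nonneg (abs_nonneg _) (by positivity) :
    0 ≤ |(g ω)| + |Z ω| ^ 2 * |g ω|)]
  nlinarith [abs_nonneg (g ω), abs_nonneg (Z ω),
    mul_nonneg (abs_nonneg (g ω)) (sq_nonneg (|Z ω| - 1)),
    mul_nonneg (abs_nonneg (g ω)) (sq_nonneg (|Z ω|))]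

theorem integral_mul_eq_integral_condExp_mul (hF : F ≤ m0) {g Y : Ω → ℝ} (hg : Measurable[F] g)
    (hY : Integrable Y μ) (hgY : Integrable (fun ω => Y ω * g ω) μ) :
    ∫ ω, Y ω * g ω ∂μ = ∫ ω, (μ[Y|F]) ω * g ω ∂μ := by
  have := condExp_mul_of_stronglyMeasurable_right hg.stronglyMeasurable hgY hY
  rw [← integral_condExp hF]
  exact integral_congr_ae this

theorem IsUnitNoise.integral_sq_mul (h : IsUnitNoise μ F Z) {g : Ω → ℝ}
    (hg : Measurable[F] g) (hgi : Integrable g μ) :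
    ∫ ω, (Z ω) ^ 2 * g ω ∂μ = ∫ ω, g ω ∂μ := by
  rw [integral_mul_eq_integral_condExp_mul h.le hg h.integrable_sq (h.integrable_sq_mul hg hgi)]
  exact integral_congr_ae (h.unit_variance.mono fun ω hω => by simp [hω])

theorem IsUnitNoise.integral_mul (h : IsUnitNoise μ F Z) {g : Ω → ℝ}
    (hg : Measurable[F] g) (hgi : Integrable g μ) : ∫ ω, Z ω * g ω ∂μ = 0 := by
  rw [integral_mul_eq_integral_condExp_mul h.le hg (h.memLp.integrable one_le_two)
    (h.integrable_mul hg hgi)]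
  rw [integral_congr_ae (g := fun _ => (0 : ℝ)) (h.mean_zero.mono fun ω hω => by simp [hω])]
  simp

theorem IsUnitNoise.memLp_mul (h : IsUnitNoise μ F Z) {g : Ω → ℝ}
    (hg : Measurable[F] g) (hgi : MemLp g 2 μ) : MemLp (fun ω => Z ω * g ω) 2 μ := by
  have hgm : Measurable g := hg.mono h.le le_rfl
  refine (memLp_two_iff_integrable_sq (h.measurable.mul hgm).aestronglyMeasurable).2 ?_
  simp only [Pi.mul_apply, mul_pow]
  exact h.integrable_sq_mul (hg.pow_const 2) hgi.integrable_sq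

/-- The optimal choice is `t = z`, reached from rational `t` by density. Rationals are used so that
the almost sure inequalities below share one null set. -/
theorem sq_le_of_forall_rat {z a : ℝ} (h : ∀ t : ℚ, 2 * (t : ℝ) * z ≤ a + (t : ℝ) ^ 2) :
    z ^ 2 ≤ a := by
  have hc : IsClosed {t : ℝ | 2 * t * z ≤ a + t ^ 2} :=
    isClosed_le (by fun_prop) (by fun_prop)
  have hz : 2 * z * z ≤ a + z ^ 2 := 
    Rat.denseRange_cast.induction_on (p := fun t => 2 * t * z ≤ a + t ^ 2) z hc h
  nlinarith

/-- Conditional Cauchy-Schwarz: `𝔼[Y Z | F]` is square integrable. -/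
theorem IsUnitNoise.memLp_condExp_mul (h : IsUnitNoise μ F Z) {Y : Ω → ℝ} (hY : MemLp Y 2 μ) :
    MemLp (μ[fun ω => Y ω * Z ω|F]) 2 μ := by
  have hYZ : Integrable (fun ω => Y ω * Z ω) μ := hY.integrable_mul h.memLp
  have hsq := hY.integrable_sq
  rw [memLp_two_iff_integrable_sq integrable_condExp.1]
  have hall : ∀ᵐ ω ∂μ, ∀ t : ℚ, 2 * (t : ℝ) * (μ[fun ω => Y ω * Z ω|F]) ω
      ≤ (μ[fun ω => (Y ω) ^ 2|F]) ω + (t : ℝ) ^ 2 := by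
    rw [ae_all_iff]
    intro t
    -- This is the conditional expectation of `(Y - t Z)² ≥ 0`, expanded; the unit variance turns
    -- the `Z²` term into `t²`.
    have h1 : μ[(2 * (t : ℝ)) • fun ω => Y ω * Z ω|F]
        ≤ᵐ[μ] μ[(fun ω => (Y ω) ^ 2) + ((t : ℝ) ^ 2) • fun ω => (Z ω) ^ 2|F] := by
      refine condExp_mono (hYZ.smul _) (hsq.add (h.integrable_sq.smul _))
        (Filter.Eventually.of_forall fun ω => ?_)
      simp only [Pi.smul_apply, Pi.add_apply, smul_eq_mul]
      nlinarith [sq_nonneg (Y ω - t * Z ω)]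
    filter_upwards [h1, condExp_smul (μ := μ) (2 * (t : ℝ)) (fun ω => Y ω * Z ω) F,
      condExp_add hsq (h.integrable_sq.smul ((t : ℝ) ^ 2)) F,
      condExp_smul (μ := μ) ((t : ℝ) ^ 2) (fun ω => (Z ω) ^ 2) F,
      h.unit_variance] with ω h1 h2 h3 h4 h5
    rw [h2, h3, Pi.add_apply, h4, Pi.smul_apply, Pi.smul_apply, h5] at h1
    simpa using h1
  refine (integrable_condExp (m := F) (f := fun ω => (Y ω) ^ 2) (μ := μ)).mono'
    (integrable_condExp.1.pow 2) (hall.mono fun ω hω => ?_)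
  rw [Real.norm_of_nonneg (by positivity)]
  exact sq_le_of_forall_rat hω

end Noise

/-! ### Integrable functions with given integral -/

/-- `f` is integrable with integral `c`. -/
def HasInt {Ω : Type*} [MeasurableSpace Ω] (μ : Measure Ω) (f : Ω → ℝ) (c : ℝ) : Prop :=
  Integrable f μ ∧ ∫ ω, f ω ∂μ = c

section HasInt

variable {Ω : Type*} [MeasurableSpace Ω] {μ : Measure Ω} {f g : Ω → ℝ} {c d : ℝ}

theorem HasInt.of_integrable (hf : Integrable f μ) : HasInt μ f (∫ ω, f ω ∂μ) := ⟨hf, rfl⟩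

theorem HasInt.add (hf : HasInt μ f c) (hg : HasInt μ g d) :
    HasInt μ (fun ω => f ω + g ω) (c + d) :=
  ⟨hf.1.add hg.1, by rw [integral_add hf.1 hg.1, hf.2, hg.2]⟩

theorem HasInt.sub (hf : HasInt μ f c) (hg : HasInt μ g d) :
    HasInt μ (fun ω => f ω - g ω) (c - d) :=
  ⟨hf.1.sub hg.1, by rw [integral_sub hf.1 hg.1, hf.2, hg.2]⟩

theorem HasInt.const_mul (r : ℝ) (hf : HasInt μ f c) : HasInt μ (fun ω => r * f ω) (r * c) :=
  ⟨hf.1.const_mul r, by rw [integral_const_mul, hf.2]⟩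

theorem HasInt.const [IsProbabilityMeasure μ] (r : ℝ) : HasInt μ (fun _ => r) r :=
  ⟨integrable_const r, by simp⟩

theorem HasInt.sum {ι : Type*} (s : Finset ι) {f : ι → Ω → ℝ} {c : ι → ℝ}
    (h : ∀ i ∈ s, HasInt μ (f i) (c i)) :
    HasInt μ (fun ω => ∑ i ∈ s, f i ω) (∑ i ∈ s, c i) :=
  ⟨integrable_finsetSum _ fun i hi => (h i hi).1, by
    rw [integral_finsetSum _ fun i hi => (h i hi).1]
    exact Finset.sum_congr rfl fun i hi => (h i hi).2⟩

end HasInt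

/-! ### Square integrable random vectors -/

section Vectors

/-- `f` is `F`-measurable and square integrable. -/
def SqAdapted {Ω : Type*} {m0 : MeasurableSpace Ω} {a : ℕ} (μ : Measure Ω)
    (F : MeasurableSpace Ω) (f : Ω → Fin a → ℝ) : Prop :=
  Measurable[F] f ∧ MemLp f 2 μ

theorem measurable_mulVec {Ω : Type*} {F : MeasurableSpace Ω} {a b : ℕ} {f : Ω → Fin a → ℝ}
    (M : Matrix (Fin b) (Fin a) ℝ) (hf : Measurable f) : Measurable fun ω => M *ᵥ f ω :=
  (Matrix.mulVecLin M).toContinuousLinearMap.continuous.measurable.comp hf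

theorem measurable_dotProduct {Ω : Type*} {F : MeasurableSpace Ω} {a : ℕ} {f g : Ω → Fin a → ℝ}
    (hf : Measurable f) (hg : Measurable g) : Measurable fun ω => f ω ⬝ᵥ g ω := by
  have hc : Continuous fun p : (Fin a → ℝ) × (Fin a → ℝ) => p.1 ⬝ᵥ p.2 := by
    unfold dotProduct; fun_prop
  exact hc.measurable.comp (hf.prodMk hg)

variable {Ω : Type*} {F : MeasurableSpace Ω} [m0 : MeasurableSpace Ω] {μ : Measure Ω} {a b : ℕ}

theorem memLp_mulVec {f : Ω → Fin a → ℝ} (M : Matrix (Fin b) (Fin a) ℝ) (hf : MemLp f 2 μ) :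
    MemLp (fun ω => M *ᵥ f ω) 2 μ :=
  (Matrix.mulVecLin M).toContinuousLinearMap.comp_memLp' hf

theorem integral_mulVec {f : Ω → Fin a → ℝ} (M : Matrix (Fin b) (Fin a) ℝ)
    (hf : Integrable f μ) : ∫ ω, M *ᵥ f ω ∂μ = M *ᵥ ∫ ω, f ω ∂μ :=
  (Matrix.mulVecLin M).toContinuousLinearMap.integral_comp_comm hf

theorem integrable_mul_of_memLp_two {f g : Ω → ℝ} (hf : MemLp f 2 μ) (hg : MemLp g 2 μ) :
    Integrable (fun ω => f ω * g ω) μ :=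
  hf.integrable_mul hg

theorem integrable_dotProduct {f g : Ω → Fin a → ℝ} (hf : MemLp f 2 μ) (hg : MemLp g 2 μ) :
    Integrable (fun ω => f ω ⬝ᵥ g ω) μ := by
  unfold dotProduct
  exact integrable_finsetSum _ fun i _ => integrable_mul_of_memLp_two (hf.eval i) (hg.eval i)

theorem integrable_const_dotProduct (c : Fin a → ℝ) {f : Ω → Fin a → ℝ} (hf : Integrable f μ) :
    Integrable (fun ω => c ⬝ᵥ f ω) μ := by
  unfold dotProduct
  exact integrable_finsetSum _ fun i _ => (hf.eval i).const_mul _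

theorem integral_const_dotProduct (c : Fin a → ℝ) {f : Ω → Fin a → ℝ} (hf : Integrable f μ) :
    ∫ ω, c ⬝ᵥ f ω ∂μ = c ⬝ᵥ ∫ ω, f ω ∂μ := by
  unfold dotProduct
  rw [integral_finsetSum _ fun i _ => (hf.eval i).const_mul _]
  simp only [integral_const_mul, eval_integral fun i => hf.eval i]

theorem integral_dotProduct_const {f : Ω → Fin a → ℝ} (hf : Integrable f μ) (c : Fin a → ℝ) :
    ∫ ω, f ω ⬝ᵥ c ∂μ = (∫ ω, f ω ∂μ) ⬝ᵥ c := by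
  simp only [dotProduct_comm _ c, integral_const_dotProduct c hf]

variable {f g : Ω → Fin a → ℝ}

theorem SqAdapted.add (hf : SqAdapted μ F f) (hg : SqAdapted μ F g) :
    SqAdapted μ F fun ω => f ω + g ω := ⟨hf.1.add hg.1, hf.2.add hg.2⟩

theorem SqAdapted.sub (hf : SqAdapted μ F f) (hg : SqAdapted μ F g) :
    SqAdapted μ F fun ω => f ω - g ω := ⟨hf.1.sub hg.1, hf.2.sub hg.2⟩

theorem SqAdapted.neg (hf : SqAdapted μ F f) : SqAdapted μ F fun ω => -f ω :=
  ⟨hf.1.neg, hf.2.neg⟩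

theorem SqAdapted.mulVec (M : Matrix (Fin b) (Fin a) ℝ) (hf : SqAdapted μ F f) :
    SqAdapted μ F fun ω => M *ᵥ f ω := ⟨measurable_mulVec M hf.1, memLp_mulVec M hf.2⟩

theorem SqAdapted.of_eval (h : ∀ i, Measurable[F] fun ω => f ω i)
    (h' : ∀ i, MemLp (fun ω => f ω i) 2 μ) : SqAdapted μ F f :=
  ⟨@measurable_pi_lambda _ _ _ F _ f h, MemLp.of_eval h'⟩

/-- The centred random vector `f - 𝔼 f`. -/
noncomputable def centred {Ω : Type*} {m0 : MeasurableSpace Ω} {a : ℕ} (μ : Measure Ω)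
    (f : Ω → Fin a → ℝ) : Ω → Fin a → ℝ := fun ω => f ω - ∫ ω', f ω' ∂μ

theorem integrable_bilin {f : Ω → Fin a → ℝ} {g : Ω → Fin b → ℝ} (M : Matrix (Fin a) (Fin b) ℝ)
    (hf : MemLp f 2 μ) (hg : MemLp g 2 μ) : Integrable (fun ω => f ω ⬝ᵥ M *ᵥ g ω) μ :=
  integrable_dotProduct hf (memLp_mulVec M hg)

theorem centred_mulVec {f : Ω → Fin a → ℝ} (M : Matrix (Fin b) (Fin a) ℝ) (hf : Integrable f μ)
    (ω : Ω) : centred μ (fun ω => M *ᵥ f ω) ω = M *ᵥ centred μ f ω := by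
  simp only [centred, integral_mulVec M hf, mulVec_sub]

variable [IsProbabilityMeasure μ]

theorem SqAdapted.integrable (h : SqAdapted μ F f) : Integrable f μ := h.2.integrable one_le_two

theorem memLp_centred {f : Ω → Fin a → ℝ} (hf : MemLp f 2 μ) : MemLp (centred μ f) 2 μ :=
  hf.sub (memLp_const _)

theorem integral_centred {f : Ω → Fin a → ℝ} (hf : Integrable f μ) :
    ∫ ω, centred μ f ω ∂μ = 0 := by
  unfold centred
  rw [integral_sub hf (integrable_const _)]
  simp

theorem centred_const (c : Fin a → ℝ) : centred μ (fun _ => c) = fun _ => 0 := by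
  funext ω; simp [centred]

/-- The covariance decomposition: the cross terms pair a constant with a centred vector and
integrate to zero. It separates the centred problem from the mean problem throughout. -/
theorem integral_dotProduct_eq {f g : Ω → Fin a → ℝ} (hf : MemLp f 2 μ) (hg : MemLp g 2 μ) :
    ∫ ω, f ω ⬝ᵥ g ω ∂μ
      = ∫ ω, centred μ f ω ⬝ᵥ centred μ g ω ∂μ + (∫ ω, f ω ∂μ) ⬝ᵥ ∫ ω, g ω ∂μ := by
  have hf' := hf.integrable one_le_two
  have hg' := hg.integrable one_le_two
  have e : ∀ ω, f ω ⬝ᵥ g ω = centred μ f ω ⬝ᵥ centred μ g ω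
      + (∫ ω, f ω ∂μ) ⬝ᵥ centred μ g ω + f ω ⬝ᵥ ∫ ω, g ω ∂μ := fun ω => by
    simp only [centred, sub_dotProduct, dotProduct_sub]; ring
  simp only [e]
  rw [integral_add, integral_add, integral_const_dotProduct, integral_dotProduct_const hf',
    integral_centred hg']
  · simp
  · exact (memLp_centred hg).integrable one_le_two
  · exact integrable_dotProduct (memLp_centred hf) (memLp_centred hg)
  · exact integrable_const_dotProduct _ ((memLp_centred hg).integrable one_le_two)
  · exact (integrable_dotProduct (memLp_centred hf) (memLp_centred hg)).add
      (integrable_const_dotProduct _ ((memLp_centred hg).integrable one_le_two))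
  · exact integrable_dotProduct hf (memLp_const _)

theorem integral_bilin_eq {f : Ω → Fin a → ℝ} {g : Ω → Fin b → ℝ} (M : Matrix (Fin a) (Fin b) ℝ)
    (hf : MemLp f 2 μ) (hg : MemLp g 2 μ) :
    ∫ ω, f ω ⬝ᵥ M *ᵥ g ω ∂μ
      = ∫ ω, centred μ f ω ⬝ᵥ M *ᵥ centred μ g ω ∂μ + (∫ ω, f ω ∂μ) ⬝ᵥ M *ᵥ ∫ ω, g ω ∂μ := by
  have hg' := hg.integrable one_le_two
  rw [integral_dotProduct_eq hf (memLp_mulVec M hg), integral_mulVec M hg']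
  simp only [centred_mulVec M hg']

theorem SqAdapted.const (c : Fin a → ℝ) : SqAdapted μ F fun _ => c :=
  ⟨measurable_const, memLp_const c⟩

theorem SqAdapted.centred (hf : SqAdapted μ F f) : SqAdapted μ F (centred μ f) :=
  hf.sub (SqAdapted.const _)

/-- The `F`-measurable representative of `Y` as a functional on `F`-measurable vectors. -/
theorem exists_sqAdapted_integral_dotProduct (hF : F ≤ m0) {Y : Ω → Fin a → ℝ}
    (hY : MemLp Y 2 μ) :
    ∃ θ : Ω → Fin a → ℝ, SqAdapted μ F θ ∧ ∀ X, SqAdapted μ F X →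
      ∫ ω, Y ω ⬝ᵥ X ω ∂μ = ∫ ω, θ ω ⬝ᵥ X ω ∂μ := by
  have hθ : SqAdapted μ F fun ω i => (μ[fun ω => Y ω i|F]) ω :=
    SqAdapted.of_eval (fun i => stronglyMeasurable_condExp.measurable)
      fun i => (hY.eval i).condExp one_le_two
  refine ⟨_, hθ, fun X hX => ?_⟩
  unfold dotProduct
  rw [integral_finsetSum _ fun i _ => integrable_mul_of_memLp_two (hY.eval i) (hX.2.eval i),
    integral_finsetSum _ fun i _ => integrable_mul_of_memLp_two (hθ.2.eval i) (hX.2.eval i)]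
  refine Finset.sum_congr rfl fun i _ => ?_
  exact integral_mul_eq_integral_condExp_mul hF ((measurable_pi_apply i).comp hX.1)
    ((hY.eval i).integrable one_le_two) ((hY.eval i).integrable_mul (hX.2.eval i))

variable {Z : Ω → ℝ}

theorem IsUnitNoise.memLp_smul (h : IsUnitNoise μ F Z) (hf : SqAdapted μ F f) :
    MemLp (fun ω => Z ω • f ω) 2 μ :=
  MemLp.of_eval fun i => h.memLp_mul ((measurable_pi_apply i).comp hf.1) (hf.2.eval i)

theorem IsUnitNoise.integral_smul (h : IsUnitNoise μ F Z) (hf : SqAdapted μ F f) :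
    ∫ ω, Z ω • f ω ∂μ = 0 := by
  funext i
  have hi := (h.memLp_smul hf).integrable one_le_two
  rw [eval_integral fun i => hi.eval i]
  exact h.integral_mul ((measurable_pi_apply i).comp hf.1) ((hf.2.eval i).integrable one_le_two)

/-- The representative is `𝔼[Y Z | F]`, componentwise. That it is square integrable, although `Y Z`
is in general only integrable, is the conditional Cauchy-Schwarz inequality. -/
theorem IsUnitNoise.exists_sqAdapted_integral_smul (h : IsUnitNoise μ F Z) {Y : Ω → Fin a → ℝ}
    (hY : MemLp Y 2 μ) :
    ∃ θ : Ω → Fin a → ℝ, SqAdapted μ F θ ∧ ∀ X, SqAdapted μ F X →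
      ∫ ω, Y ω ⬝ᵥ (Z ω • X ω) ∂μ = ∫ ω, θ ω ⬝ᵥ X ω ∂μ := by
  have hθ : SqAdapted μ F fun ω i => (μ[fun ω => Y ω i * Z ω|F]) ω :=
    SqAdapted.of_eval (fun i => stronglyMeasurable_condExp.measurable)
      fun i => h.memLp_condExp_mul (hY.eval i)
  refine ⟨_, hθ, fun X hX => ?_⟩
  have hZX := h.memLp_smul hX
  unfold dotProduct
  rw [integral_finsetSum _ fun i _ => integrable_mul_of_memLp_two (hY.eval i) (hZX.eval i),
    integral_finsetSum _ fun i _ => integrable_mul_of_memLp_two (hθ.2.eval i) (hX.2.eval i)]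
  refine Finset.sum_congr rfl fun i _ => ?_
  have e : (fun ω => Y ω i * (Z ω • X ω) i) = fun ω => (Y ω i * Z ω) * X ω i := by
    funext ω; simp [mul_assoc]
  have hi : Integrable (fun ω => (Y ω i * Z ω) * X ω i) μ := by
    rw [← e]; exact (hY.eval i).integrable_mul (hZX.eval i)
  rw [e]
  exact integral_mul_eq_integral_condExp_mul h.le ((measurable_pi_apply i).comp hX.1)
    ((hY.eval i).integrable_mul h.memLp) hi

/-- Second moments of `f + Z g` for `F`-measurable `f`, `g`. -/
theorem IsUnitNoise.integral_quadratic (h : IsUnitNoise μ F Z) (M : Matrix (Fin a) (Fin a) ℝ)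
    (hf : SqAdapted μ F f) (hg : SqAdapted μ F g) :
    ∫ ω, (f ω + Z ω • g ω) ⬝ᵥ M *ᵥ (f ω + Z ω • g ω) ∂μ
      = ∫ ω, f ω ⬝ᵥ M *ᵥ f ω ∂μ + ∫ ω, g ω ⬝ᵥ M *ᵥ g ω ∂μ := by
  have m₁ : Measurable[F] fun ω => f ω ⬝ᵥ M *ᵥ g ω + g ω ⬝ᵥ M *ᵥ f ω :=
    (measurable_dotProduct hf.1 (measurable_mulVec M hg.1)).add
      (measurable_dotProduct hg.1 (measurable_mulVec M hf.1))
  have i₁ : Integrable (fun ω => f ω ⬝ᵥ M *ᵥ g ω + g ω ⬝ᵥ M *ᵥ f ω) μ :=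
    (integrable_bilin M hf.2 hg.2).add (integrable_bilin M hg.2 hf.2)
  have m₂ : Measurable[F] fun ω => g ω ⬝ᵥ M *ᵥ g ω :=
    measurable_dotProduct hg.1 (measurable_mulVec M hg.1)
  have i₂ := integrable_bilin M hg.2 hg.2
  have i₀ := integrable_bilin M hf.2 hf.2
  have e : ∀ ω, (f ω + Z ω • g ω) ⬝ᵥ M *ᵥ (f ω + Z ω • g ω) = f ω ⬝ᵥ M *ᵥ f ω
      + Z ω * (f ω ⬝ᵥ M *ᵥ g ω + g ω ⬝ᵥ M *ᵥ f ω) + (Z ω) ^ 2 * (g ω ⬝ᵥ M *ᵥ g ω) := fun ω => by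
    simp only [mulVec_add, mulVec_smul, add_dotProduct, dotProduct_add, smul_dotProduct,
      dotProduct_smul, smul_eq_mul]
    ring
  simp only [e]
  refine ((HasInt.of_integrable i₀).add ⟨h.integrable_mul m₁ i₁, h.integral_mul m₁ i₁⟩ |>.add
    ⟨h.integrable_sq_mul m₂ i₂, h.integral_sq_mul m₂ i₂⟩).2.trans ?_
  rw [add_zero]

end Vectors

/-! ### One step of the state equation and of the cost -/

section OneStep

variable {Ω : Type*} {F F' : MeasurableSpace Ω} [m0 : MeasurableSpace Ω] {n m : ℕ}

/-- The right-hand side of the state equation at time `k`. -/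
noncomputable def nextState (sys : System n m) (μ : Measure Ω) (k : ℕ) (Z : Ω → ℝ)
    (X : Ω → Fin n → ℝ) (U : Ω → Fin m → ℝ) : Ω → Fin n → ℝ := fun ω =>
  sys.A k *ᵥ X ω + sys.Abar k *ᵥ (∫ ω', X ω' ∂μ) + sys.B k *ᵥ U ω
    + sys.Bbar k *ᵥ (∫ ω', U ω' ∂μ) + sys.b k
    + Z ω • (sys.C k *ᵥ X ω + sys.Cbar k *ᵥ (∫ ω', X ω' ∂μ) + sys.D k *ᵥ U ω
      + sys.Dbar k *ᵥ (∫ ω', U ω' ∂μ) + sys.σ k)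

/-- The expected running cost at time `k`. -/
noncomputable def runCost (sys : System n m) (w : RandomWeights Ω n m) (μ : Measure Ω) (k : ℕ)
    (X : Ω → Fin n → ℝ) (U : Ω → Fin m → ℝ) : ℝ :=
  let Ex := ∫ ω, X ω ∂μ
  let Eu := ∫ ω, U ω ∂μ
  ∫ ω, (X ω ⬝ᵥ sys.Q k *ᵥ X ω + 2 * (X ω ⬝ᵥ sys.S k *ᵥ U ω) + U ω ⬝ᵥ sys.R k *ᵥ U ω
    + 2 * (w.q k ω ⬝ᵥ X ω + w.ρ k ω ⬝ᵥ U ω)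
    + Ex ⬝ᵥ sys.Qbar k *ᵥ Ex + 2 * (Ex ⬝ᵥ sys.Sbar k *ᵥ Eu) + Eu ⬝ᵥ sys.Rbar k *ᵥ Eu
    + 2 * (w.qbar k ω ⬝ᵥ Ex + w.ρbar k ω ⬝ᵥ Eu)) ∂μ

/-- A quadratic functional of a random state, with a random and a deterministic linear weight. -/
noncomputable def valueFn (μ : Measure Ω) (P Pi : Matrix (Fin n) (Fin n) ℝ) (Y : Ω → Fin n → ℝ)
    (y : Fin n → ℝ) (X : Ω → Fin n → ℝ) : ℝ :=
  ∫ ω, centred μ X ω ⬝ᵥ P *ᵥ centred μ X ω ∂μ + (∫ ω, X ω ∂μ) ⬝ᵥ Pi *ᵥ ∫ ω, X ω ∂μ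
    + 2 * ∫ ω, Y ω ⬝ᵥ centred μ X ω ∂μ + 2 * (y ⬝ᵥ ∫ ω, X ω ∂μ)

/-- The linear weight `Y` on the centred next state, together with the current linear weights,
acts on centred states and controls like the weights `h`, `r`, and like `κ` on the deterministic
part of the diffusion. -/
def IsAdjointStep (sys : System n m) (w : RandomWeights Ω n m) (μ : Measure Ω)
    (F : MeasurableSpace Ω) (Z : Ω → ℝ) (k : ℕ) (Y h : Ω → Fin n → ℝ) (r : Ω → Fin m → ℝ)
    (κ : Fin n → ℝ) : Prop :=
  ∀ (X : Ω → Fin n → ℝ) (U : Ω → Fin m → ℝ) (c : Fin n → ℝ), SqAdapted μ F X → SqAdapted μ F U →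
    ∫ ω, X ω ∂μ = 0 → ∫ ω, U ω ∂μ = 0 →
    ∫ ω, Y ω ⬝ᵥ (sys.A k *ᵥ X ω + sys.B k *ᵥ U ω
        + Z ω • (sys.C k *ᵥ X ω + sys.D k *ᵥ U ω + c)) ∂μ
      + ∫ ω, centred μ (w.q k) ω ⬝ᵥ X ω ∂μ + ∫ ω, centred μ (w.ρ k) ω ⬝ᵥ U ω ∂μ
    = ∫ ω, h ω ⬝ᵥ X ω ∂μ + ∫ ω, r ω ⬝ᵥ U ω ∂μ + κ ⬝ᵥ c

variable (sys : System n m) {w : RandomWeights Ω n m} {μ : Measure Ω} {Z : Ω → ℝ} (k : ℕ)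
  {X : Ω → Fin n → ℝ} {U : Ω → Fin m → ℝ}

/-- The mean of the next state. -/
noncomputable def meanNext (x : Fin n → ℝ) (u : Fin m → ℝ) : Fin n → ℝ :=
  (sys.A k + sys.Abar k) *ᵥ x + (sys.B k + sys.Bbar k) *ᵥ u + sys.b k

/-- The mean of the diffusion term. -/
noncomputable def meanDiffusion (x : Fin n → ℝ) (u : Fin m → ℝ) : Fin n → ℝ :=
  (sys.C k + sys.Cbar k) *ᵥ x + (sys.D k + sys.Dbar k) *ᵥ u + sys.σ k

/-- The barred coefficients enter only through the two mean vectors. The mean diffusion stays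
multiplied by the noise, so it contributes to the variance of the next state and not to its mean. -/
theorem nextState_eq (ω : Ω) :
    nextState sys μ k Z X U ω
      = sys.A k *ᵥ centred μ X ω + sys.B k *ᵥ centred μ U ω
        + Z ω • (sys.C k *ᵥ centred μ X ω + sys.D k *ᵥ centred μ U ω
          + meanDiffusion sys k (∫ ω, X ω ∂μ) (∫ ω, U ω ∂μ))
        + meanNext sys k (∫ ω, X ω ∂μ) (∫ ω, U ω ∂μ) := by
  simp only [nextState, meanDiffusion, meanNext, centred, mulVec_sub, add_mulVec]
  have e : sys.C k *ᵥ X ω + sys.Cbar k *ᵥ (∫ ω', X ω' ∂μ) + sys.D k *ᵥ U ω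
      + sys.Dbar k *ᵥ (∫ ω', U ω' ∂μ) + sys.σ k
      = sys.C k *ᵥ X ω - sys.C k *ᵥ (∫ ω', X ω' ∂μ) + (sys.D k *ᵥ U ω
        - sys.D k *ᵥ (∫ ω', U ω' ∂μ)) + (sys.C k *ᵥ (∫ ω', X ω' ∂μ)
        + sys.Cbar k *ᵥ (∫ ω', X ω' ∂μ) + (sys.D k *ᵥ (∫ ω', U ω' ∂μ)
        + sys.Dbar k *ᵥ (∫ ω', U ω' ∂μ)) + sys.σ k) := by abel
  rw [e]
  abel

variable {sys k}

variable {P Pi : ℕ → Matrix (Fin n) (Fin n) ℝ}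

/-- The linear weight of the mean state produced by one backward step. -/
noncomputable def meanWeightState (sys : System n m) (w : RandomWeights Ω n m) (μ : Measure Ω)
    (P Pi : ℕ → Matrix (Fin n) (Fin n) ℝ) (k : ℕ) (y κ : Fin n → ℝ) : Fin n → ℝ :=
  (sys.C k + sys.Cbar k)ᵀ *ᵥ (P (k + 1) *ᵥ sys.σ k + κ)
    + (sys.A k + sys.Abar k)ᵀ *ᵥ (Pi (k + 1) *ᵥ sys.b k + y)
    + (∫ ω, w.q k ω ∂μ + ∫ ω, w.qbar k ω ∂μ)

/-- The linear weight of the mean control produced by one backward step. -/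
noncomputable def meanWeightControl (sys : System n m) (w : RandomWeights Ω n m) (μ : Measure Ω)
    (P Pi : ℕ → Matrix (Fin n) (Fin n) ℝ) (k : ℕ) (y κ : Fin n → ℝ) : Fin m → ℝ :=
  (sys.D k + sys.Dbar k)ᵀ *ᵥ (P (k + 1) *ᵥ sys.σ k + κ)
    + (sys.B k + sys.Bbar k)ᵀ *ᵥ (Pi (k + 1) *ᵥ sys.b k + y)
    + (∫ ω, w.ρ k ω ∂μ + ∫ ω, w.ρbar k ω ∂μ)

/-- The mean problem is a deterministic one-step problem whose drift is weighted by `Π` and whose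
diffusion is weighted by `P`. The vector `κ` records how the random linear weight acts on the mean
diffusion. -/
theorem mean_step_eq (hP : (P (k + 1)).IsSymm) (hPi : (Pi (k + 1)).IsSymm) (y κ x : Fin n → ℝ)
    (u : Fin m → ℝ) :
    meanNext sys k x u ⬝ᵥ Pi (k + 1) *ᵥ meanNext sys k x u
      + meanDiffusion sys k x u ⬝ᵥ P (k + 1) *ᵥ meanDiffusion sys k x u
      + x ⬝ᵥ (sys.Q k + sys.Qbar k) *ᵥ x + 2 * (x ⬝ᵥ (sys.S k + sys.Sbar k) *ᵥ u)
      + u ⬝ᵥ (sys.R k + sys.Rbar k) *ᵥ u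
      + 2 * (y ⬝ᵥ meanNext sys k x u) + 2 * (κ ⬝ᵥ meanDiffusion sys k x u)
      + 2 * ((∫ ω, w.q k ω ∂μ + ∫ ω, w.qbar k ω ∂μ) ⬝ᵥ x
          + (∫ ω, w.ρ k ω ∂μ + ∫ ω, w.ρbar k ω ∂μ) ⬝ᵥ u)
    = x ⬝ᵥ (sys.Q k + sys.Qbar k
          + (sys.A k + sys.Abar k)ᵀ * Pi (k + 1) * (sys.A k + sys.Abar k)
          + (sys.C k + sys.Cbar k)ᵀ * P (k + 1) * (sys.C k + sys.Cbar k)) *ᵥ x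
      + 2 * (u ⬝ᵥ HBar sys P Pi k *ᵥ x) + u ⬝ᵥ UpsBar sys P Pi k *ᵥ u
      + 2 * (meanWeightState sys w μ P Pi k y κ ⬝ᵥ x)
      + 2 * (meanWeightControl sys w μ P Pi k y κ ⬝ᵥ u)
      + (sys.b k ⬝ᵥ Pi (k + 1) *ᵥ sys.b k + sys.σ k ⬝ᵥ P (k + 1) *ᵥ sys.σ k
        + 2 * (y ⬝ᵥ sys.b k) + 2 * (κ ⬝ᵥ sys.σ k)) := by
  have hq := one_step_quadratic (Q := sys.Q k + sys.Qbar k) (sys.A k + sys.Abar k)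
    (sys.C k + sys.Cbar k) (sys.B k + sys.Bbar k) (sys.D k + sys.Dbar k) (sys.S k + sys.Sbar k)
    (sys.R k + sys.Rbar k) hPi hP x u
  have hH : HBar sys P Pi k = (sys.B k + sys.Bbar k)ᵀ * Pi (k + 1) * (sys.A k + sys.Abar k)
      + (sys.D k + sys.Dbar k)ᵀ * P (k + 1) * (sys.C k + sys.Cbar k)
      + (sys.S k + sys.Sbar k)ᵀ := by
    rw [HBar, transpose_add (sys.S k), add_assoc _ _ (sys.Sbar k)ᵀ]
  rw [← hH] at hq
  have hU : UpsBar sys P Pi k = sys.R k + sys.Rbar k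
    + (sys.B k + sys.Bbar k)ᵀ * Pi (k + 1) * (sys.B k + sys.Bbar k)
    + (sys.D k + sys.Dbar k)ᵀ * P (k + 1) * (sys.D k + sys.Dbar k) := rfl
  rw [← hU] at hq
  have quad : ∀ (M : Matrix (Fin n) (Fin n) ℝ), M.IsSymm → ∀ z c : Fin n → ℝ,
      (z + c) ⬝ᵥ M *ᵥ (z + c) = z ⬝ᵥ M *ᵥ z + 2 * ((M *ᵥ c) ⬝ᵥ z) + c ⬝ᵥ M *ᵥ c := by
    intro M hM z c
    have : c ⬝ᵥ M *ᵥ z = z ⬝ᵥ M *ᵥ c := by rw [dotProduct_mulVec_comm, hM.eq]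
    simp only [mulVec_add, add_dotProduct, dotProduct_add, this, dotProduct_comm (M *ᵥ c) z]
    ring
  have tr : ∀ {a b : ℕ} (M : Matrix (Fin a) (Fin b) ℝ) (p : Fin a → ℝ) (z : Fin b → ℝ),
      (Mᵀ *ᵥ p) ⬝ᵥ z = p ⬝ᵥ M *ᵥ z := by
    intro a b M p z
    rw [dotProduct_mulVec_comm, dotProduct_comm]
  rw [meanNext, meanDiffusion, quad _ hPi, quad _ hP]
  simp only [meanWeightState, meanWeightControl,
    add_dotProduct _ _ x, add_dotProduct _ _ u, tr]
  simp only [dotProduct_add, add_dotProduct, mulVec_add] at hq ⊢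
  linarith

variable [IsProbabilityMeasure μ]

theorem sqAdapted_affine (hX : SqAdapted μ F X) (hU : SqAdapted μ F U)
    (A : Matrix (Fin n) (Fin n) ℝ) (B : Matrix (Fin n) (Fin m) ℝ) :
    SqAdapted μ F fun ω => A *ᵥ centred μ X ω + B *ᵥ centred μ U ω :=
  (hX.centred.mulVec A).add (hU.centred.mulVec B)

theorem integral_affine (hX : SqAdapted μ F X) (hU : SqAdapted μ F U)
    (A : Matrix (Fin n) (Fin n) ℝ) (B : Matrix (Fin n) (Fin m) ℝ) :
    ∫ ω, A *ᵥ centred μ X ω + B *ᵥ centred μ U ω ∂μ = 0 := by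
  rw [integral_add (hX.centred.mulVec A).integrable (hU.centred.mulVec B).integrable,
    integral_mulVec _ hX.centred.integrable, integral_mulVec _ hU.centred.integrable,
    integral_centred hX.integrable, integral_centred hU.integrable]
  simp

theorem memLp_nextState (h : IsUnitNoise μ F Z) (hX : SqAdapted μ F X) (hU : SqAdapted μ F U) :
    MemLp (nextState sys μ k Z X U) 2 μ := by
  have e : nextState sys μ k Z X U = _ := funext fun ω => nextState_eq sys k ω
  rw [e]
  exact ((sqAdapted_affine hX hU _ _).2.add
    (h.memLp_smul ((sqAdapted_affine hX hU _ _).add (SqAdapted.const _)))).add (memLp_const _)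

theorem sqAdapted_nextState (h : IsUnitNoise μ F Z) (hF : F ≤ F') (hZ : Measurable[F'] Z)
    (hX : SqAdapted μ F X) (hU : SqAdapted μ F U) :
    SqAdapted μ F' (nextState sys μ k Z X U) := by
  refine ⟨?_, memLp_nextState h hX hU⟩
  have hX' := hX.1.mono hF le_rfl
  have hU' := hU.1.mono hF le_rfl
  have mX : ∀ {a : ℕ} (A : Matrix (Fin a) (Fin n) ℝ), Measurable[F'] fun ω => A *ᵥ X ω :=
    fun A => measurable_mulVec A hX'
  have mU : ∀ {a : ℕ} (A : Matrix (Fin a) (Fin m) ℝ), Measurable[F'] fun ω => A *ᵥ U ω :=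
    fun A => measurable_mulVec A hU'
  exact (((((mX _).add measurable_const).add (mU _)).add measurable_const).add
    measurable_const).add (hZ.smul (((((mX _).add measurable_const).add (mU _)).add
      measurable_const).add measurable_const))

theorem integral_nextState (h : IsUnitNoise μ F Z) (hX : SqAdapted μ F X)
    (hU : SqAdapted μ F U) :
    ∫ ω, nextState sys μ k Z X U ω ∂μ = meanNext sys k (∫ ω, X ω ∂μ) (∫ ω, U ω ∂μ) := by
  have ha := sqAdapted_affine hX hU (sys.A k) (sys.B k)
  have hf := (sqAdapted_affine hX hU (sys.C k) (sys.D k)).add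
    (SqAdapted.const (μ := μ) (meanDiffusion sys k (∫ ω, X ω ∂μ) (∫ ω, U ω ∂μ)))
  have hi : Integrable (fun ω => sys.A k *ᵥ centred μ X ω + sys.B k *ᵥ centred μ U ω
      + Z ω • (sys.C k *ᵥ centred μ X ω + sys.D k *ᵥ centred μ U ω
        + meanDiffusion sys k (∫ ω, X ω ∂μ) (∫ ω, U ω ∂μ))) μ :=
    ha.integrable.add ((h.memLp_smul hf).integrable one_le_two)
  simp only [nextState_eq]
  rw [integral_add hi (integrable_const _), integral_add ha.integrable ((h.memLp_smul hf).integrable one_le_two),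
    integral_affine hX hU, h.integral_smul hf]
  simp

theorem centred_nextState (h : IsUnitNoise μ F Z) (hX : SqAdapted μ F X)
    (hU : SqAdapted μ F U) (ω : Ω) :
    centred μ (nextState sys μ k Z X U) ω
      = sys.A k *ᵥ centred μ X ω + sys.B k *ᵥ centred μ U ω
        + Z ω • (sys.C k *ᵥ centred μ X ω + sys.D k *ᵥ centred μ U ω
          + meanDiffusion sys k (∫ ω, X ω ∂μ) (∫ ω, U ω ∂μ)) := by
  rw [centred, integral_nextState h hX hU, nextState_eq]
  exact add_sub_cancel_right _ _

/-- Applied to the diffusion coefficient, this splits off its mean, which is how `P` comes to appear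
in the equation for `Π`. -/
theorem integral_quadratic_add_const {f : Ω → Fin n → ℝ} (M : Matrix (Fin n) (Fin n) ℝ)
    (hf : MemLp f 2 μ) (h0 : ∫ ω, f ω ∂μ = 0) (c : Fin n → ℝ) :
    ∫ ω, (f ω + c) ⬝ᵥ M *ᵥ (f ω + c) ∂μ = ∫ ω, f ω ⬝ᵥ M *ᵥ f ω ∂μ + c ⬝ᵥ M *ᵥ c := by
  have hm : ∫ ω, f ω + c ∂μ = c := by
    rw [integral_add (hf.integrable one_le_two) (integrable_const _), h0]; simp
  have hc : centred μ (fun ω => f ω + c) = f := by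
    funext ω; simp [centred, hm]
  have hfc : MemLp (fun ω => f ω + c) 2 μ := hf.add (memLp_const _)
  rw [integral_bilin_eq M hfc hfc, hc, hm]

/-- The running cost in terms of centred processes and means. -/
theorem runCost_eq (hw : MemLp (w.q k) 2 μ) (hwb : MemLp (w.qbar k) 2 μ) (hρ : MemLp (w.ρ k) 2 μ)
    (hρb : MemLp (w.ρbar k) 2 μ) (hX : MemLp X 2 μ) (hU : MemLp U 2 μ) :
    Integrable (fun ω =>
      X ω ⬝ᵥ sys.Q k *ᵥ X ω + 2 * (X ω ⬝ᵥ sys.S k *ᵥ U ω) + U ω ⬝ᵥ sys.R k *ᵥ U ω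
      + 2 * (w.q k ω ⬝ᵥ X ω + w.ρ k ω ⬝ᵥ U ω)
      + (∫ ω, X ω ∂μ) ⬝ᵥ sys.Qbar k *ᵥ (∫ ω, X ω ∂μ)
      + 2 * ((∫ ω, X ω ∂μ) ⬝ᵥ sys.Sbar k *ᵥ (∫ ω, U ω ∂μ))
      + (∫ ω, U ω ∂μ) ⬝ᵥ sys.Rbar k *ᵥ (∫ ω, U ω ∂μ)
      + 2 * (w.qbar k ω ⬝ᵥ (∫ ω, X ω ∂μ) + w.ρbar k ω ⬝ᵥ (∫ ω, U ω ∂μ))) μ ∧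
    runCost sys w μ k X U
      = ∫ ω, centred μ X ω ⬝ᵥ sys.Q k *ᵥ centred μ X ω ∂μ
        + 2 * ∫ ω, centred μ X ω ⬝ᵥ sys.S k *ᵥ centred μ U ω ∂μ
        + ∫ ω, centred μ U ω ⬝ᵥ sys.R k *ᵥ centred μ U ω ∂μ
        + 2 * (∫ ω, centred μ (w.q k) ω ⬝ᵥ centred μ X ω ∂μ
          + ∫ ω, centred μ (w.ρ k) ω ⬝ᵥ centred μ U ω ∂μ)
        + (∫ ω, X ω ∂μ) ⬝ᵥ (sys.Q k + sys.Qbar k) *ᵥ (∫ ω, X ω ∂μ)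
        + 2 * ((∫ ω, X ω ∂μ) ⬝ᵥ (sys.S k + sys.Sbar k) *ᵥ (∫ ω, U ω ∂μ))
        + (∫ ω, U ω ∂μ) ⬝ᵥ (sys.R k + sys.Rbar k) *ᵥ (∫ ω, U ω ∂μ)
        + 2 * ((∫ ω, w.q k ω ∂μ + ∫ ω, w.qbar k ω ∂μ) ⬝ᵥ (∫ ω, X ω ∂μ)
          + (∫ ω, w.ρ k ω ∂μ + ∫ ω, w.ρbar k ω ∂μ) ⬝ᵥ (∫ ω, U ω ∂μ)) := by
  have key := ((((((((HasInt.of_integrable (integrable_bilin (sys.Q k) hX hX)).add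
    ((HasInt.of_integrable (integrable_bilin (sys.S k) hX hU)).const_mul 2)).add
    (HasInt.of_integrable (integrable_bilin (sys.R k) hU hU))).add
    (((HasInt.of_integrable (integrable_dotProduct hw hX)).add
      (HasInt.of_integrable (integrable_dotProduct hρ hU))).const_mul 2)).add
    (HasInt.const (μ := μ) ((∫ ω, X ω ∂μ) ⬝ᵥ sys.Qbar k *ᵥ (∫ ω, X ω ∂μ)))).add
    (HasInt.const (μ := μ) (2 * ((∫ ω, X ω ∂μ) ⬝ᵥ sys.Sbar k *ᵥ (∫ ω, U ω ∂μ))))).add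
    (HasInt.const (μ := μ) ((∫ ω, U ω ∂μ) ⬝ᵥ sys.Rbar k *ᵥ (∫ ω, U ω ∂μ)))).add
    (((HasInt.of_integrable (integrable_dotProduct hwb (memLp_const (∫ ω, X ω ∂μ)))).add
      (HasInt.of_integrable (integrable_dotProduct hρb
        (memLp_const (∫ ω, U ω ∂μ))))).const_mul 2))
  refine ⟨key.1, ?_⟩
  rw [runCost, key.2, integral_bilin_eq _ hX hX, integral_bilin_eq _ hX hU,
    integral_bilin_eq _ hU hU, integral_dotProduct_eq hw hX, integral_dotProduct_eq hρ hU,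
    integral_dotProduct_const (hwb.integrable one_le_two),
    integral_dotProduct_const (hρb.integrable one_le_two)]
  simp only [add_mulVec, dotProduct_add, add_dotProduct]
  ring

/-- One step of the dynamic programming recursion, before completing the square. -/
theorem valueFn_nextState_add_runCost (hP : (P (k + 1)).IsSymm) (hPi : (Pi (k + 1)).IsSymm)
    (hZ : IsUnitNoise μ F Z) (hw : MemLp (w.q k) 2 μ) (hwb : MemLp (w.qbar k) 2 μ)
    (hρ : MemLp (w.ρ k) 2 μ) (hρb : MemLp (w.ρbar k) 2 μ)
    {Y h : Ω → Fin n → ℝ} {r : Ω → Fin m → ℝ} {κ y : Fin n → ℝ}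
    (hh : MemLp h 2 μ) (hr : MemLp r 2 μ)
    (hadj : IsAdjointStep sys w μ F Z k Y h r κ) (hX : SqAdapted μ F X) (hU : SqAdapted μ F U) :
    valueFn μ (P (k + 1)) (Pi (k + 1)) Y y (nextState sys μ k Z X U) + runCost sys w μ k X U
    = ∫ ω, (centred μ X ω ⬝ᵥ (sys.Q k + (sys.A k)ᵀ * P (k + 1) * sys.A k
          + (sys.C k)ᵀ * P (k + 1) * sys.C k) *ᵥ centred μ X ω
        + 2 * (centred μ U ω ⬝ᵥ Hmat sys P k *ᵥ centred μ X ω)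
        + centred μ U ω ⬝ᵥ Ups sys P k *ᵥ centred μ U ω
        + 2 * (h ω ⬝ᵥ centred μ X ω) + 2 * (r ω ⬝ᵥ centred μ U ω)) ∂μ
      + ((∫ ω, X ω ∂μ) ⬝ᵥ (sys.Q k + sys.Qbar k
          + (sys.A k + sys.Abar k)ᵀ * Pi (k + 1) * (sys.A k + sys.Abar k)
          + (sys.C k + sys.Cbar k)ᵀ * P (k + 1) * (sys.C k + sys.Cbar k)) *ᵥ (∫ ω, X ω ∂μ)
        + 2 * ((∫ ω, U ω ∂μ) ⬝ᵥ HBar sys P Pi k *ᵥ (∫ ω, X ω ∂μ))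
        + (∫ ω, U ω ∂μ) ⬝ᵥ UpsBar sys P Pi k *ᵥ (∫ ω, U ω ∂μ)
        + 2 * (meanWeightState sys w μ P Pi k y κ ⬝ᵥ (∫ ω, X ω ∂μ))
        + 2 * (meanWeightControl sys w μ P Pi k y κ ⬝ᵥ (∫ ω, U ω ∂μ)))
      + (sys.b k ⬝ᵥ Pi (k + 1) *ᵥ sys.b k + sys.σ k ⬝ᵥ P (k + 1) *ᵥ sys.σ k
        + 2 * (y ⬝ᵥ sys.b k) + 2 * (κ ⬝ᵥ sys.σ k)) := by
  have hXc := hX.centred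
  have hUc := hU.centred
  have ha := sqAdapted_affine hX hU (sys.A k) (sys.B k)
  have hf := sqAdapted_affine hX hU (sys.C k) (sys.D k)
  -- The free vector in the adjoint identity is taken to be the mean diffusion, so that the argument
  -- of `Y` is exactly the centred next state.
  have hadj' := hadj _ _ (meanDiffusion sys k (∫ ω, X ω ∂μ) (∫ ω, U ω ∂μ)) hXc hUc
    (integral_centred hX.integrable) (integral_centred hU.integrable)
  have e₁ : ∫ ω, (centred μ X ω ⬝ᵥ (sys.Q k + (sys.A k)ᵀ * P (k + 1) * sys.A k
          + (sys.C k)ᵀ * P (k + 1) * sys.C k) *ᵥ centred μ X ω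
        + 2 * (centred μ U ω ⬝ᵥ Hmat sys P k *ᵥ centred μ X ω)
        + centred μ U ω ⬝ᵥ Ups sys P k *ᵥ centred μ U ω
        + 2 * (h ω ⬝ᵥ centred μ X ω) + 2 * (r ω ⬝ᵥ centred μ U ω)) ∂μ
      = ∫ ω, (sys.A k *ᵥ centred μ X ω + sys.B k *ᵥ centred μ U ω) ⬝ᵥ
            P (k + 1) *ᵥ (sys.A k *ᵥ centred μ X ω + sys.B k *ᵥ centred μ U ω) ∂μ
        + ∫ ω, (sys.C k *ᵥ centred μ X ω + sys.D k *ᵥ centred μ U ω) ⬝ᵥ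
            P (k + 1) *ᵥ (sys.C k *ᵥ centred μ X ω + sys.D k *ᵥ centred μ U ω) ∂μ
        + ∫ ω, centred μ X ω ⬝ᵥ sys.Q k *ᵥ centred μ X ω ∂μ
        + 2 * ∫ ω, centred μ X ω ⬝ᵥ sys.S k *ᵥ centred μ U ω ∂μ
        + ∫ ω, centred μ U ω ⬝ᵥ sys.R k *ᵥ centred μ U ω ∂μ
        + 2 * ∫ ω, h ω ⬝ᵥ centred μ X ω ∂μ + 2 * ∫ ω, r ω ⬝ᵥ centred μ U ω ∂μ := by
    have key := ((((((HasInt.of_integrable (integrable_bilin (P (k + 1)) ha.2 ha.2)).add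
      (HasInt.of_integrable (integrable_bilin (P (k + 1)) hf.2 hf.2))).add
      (HasInt.of_integrable (integrable_bilin (sys.Q k) hXc.2 hXc.2))).add
      ((HasInt.of_integrable (integrable_bilin (sys.S k) hXc.2 hUc.2)).const_mul 2)).add
      (HasInt.of_integrable (integrable_bilin (sys.R k) hUc.2 hUc.2))).add
      ((HasInt.of_integrable (integrable_dotProduct hh hXc.2)).const_mul 2)).add
      ((HasInt.of_integrable (integrable_dotProduct hr hUc.2)).const_mul 2)
    rw [← key.2]
    refine integral_congr_ae (Filter.Eventually.of_forall fun ω => ?_)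
    have := one_step_quadratic (Q := sys.Q k) (sys.A k) (sys.C k) (sys.B k) (sys.D k) (sys.S k)
      (sys.R k) hP hP (centred μ X ω) (centred μ U ω)
    simp only [this, Hmat, Ups]
  rw [e₁, valueFn, integral_nextState hZ hX hU,
    (runCost_eq hw hwb hρ hρb hX.2 hU.2).2]
  simp only [centred_nextState hZ hX hU]
  rw [hZ.integral_quadratic _ ha (hf.add (SqAdapted.const _)),
    integral_quadratic_add_const _ hf.2 (integral_affine hX hU _ _)]
  have hm := mean_step_eq (sys := sys) (w := w) (μ := μ) hP hPi y κ (∫ ω, X ω ∂μ) (∫ ω, U ω ∂μ)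
  linarith

/-- The random linear weight of the centred state produced by one backward step. -/
noncomputable def nextWeight (sys : System n m) (P : ℕ → Matrix (Fin n) (Fin n) ℝ) (k : ℕ)
    (h : Ω → Fin n → ℝ) (r : Ω → Fin m → ℝ) : Ω → Fin n → ℝ := fun ω =>
  h ω - (Hmat sys P k)ᵀ *ᵥ (mpInv (Ups sys P k) *ᵥ r ω)

/-- The deviation of the centred control from its optimal value. -/
noncomputable def centredGap (sys : System n m) (μ : Measure Ω)
    (P : ℕ → Matrix (Fin n) (Fin n) ℝ) (k : ℕ) (r : Ω → Fin m → ℝ) (X : Ω → Fin n → ℝ)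
    (U : Ω → Fin m → ℝ) : Ω → Fin m → ℝ := fun ω =>
  centred μ U ω + mpInv (Ups sys P k) *ᵥ (Hmat sys P k *ᵥ centred μ X ω + r ω)

/-- The deviation of the mean control from its optimal value. -/
noncomputable def meanGap (sys : System n m) (P Pi : ℕ → Matrix (Fin n) (Fin n) ℝ) (k : ℕ)
    (s : Fin m → ℝ) (x : Fin n → ℝ) (u : Fin m → ℝ) : Fin m → ℝ :=
  u + mpInv (UpsBar sys P Pi k) *ᵥ (HBar sys P Pi k *ᵥ x + s)

/-- The excess cost incurred at time `k`. -/
noncomputable def excess (sys : System n m) (μ : Measure Ω)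
    (P Pi : ℕ → Matrix (Fin n) (Fin n) ℝ) (k : ℕ) (r : Ω → Fin m → ℝ) (s : Fin m → ℝ)
    (X : Ω → Fin n → ℝ) (U : Ω → Fin m → ℝ) : ℝ :=
  ∫ ω, centredGap sys μ P k r X U ω ⬝ᵥ Ups sys P k *ᵥ centredGap sys μ P k r X U ω ∂μ
    + meanGap sys P Pi k s (∫ ω, X ω ∂μ) (∫ ω, U ω ∂μ) ⬝ᵥ
      UpsBar sys P Pi k *ᵥ meanGap sys P Pi k s (∫ ω, X ω ∂μ) (∫ ω, U ω ∂μ)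

theorem memLp_centredGap {r : Ω → Fin m → ℝ} (hr : MemLp r 2 μ) (hX : MemLp X 2 μ)
    (hU : MemLp U 2 μ) : MemLp (centredGap sys μ P k r X U) 2 μ :=
  (memLp_centred hU).add (memLp_mulVec _ ((memLp_mulVec _ (memLp_centred hX)).add hr))

/-- The part of one step of the dynamic programming recursion that does not depend on the state
and the control. -/
noncomputable def stepConst (sys : System n m) (w : RandomWeights Ω n m) (μ : Measure Ω)
    (P Pi : ℕ → Matrix (Fin n) (Fin n) ℝ) (k : ℕ) (r : Ω → Fin m → ℝ) (y κ : Fin n → ℝ) : ℝ :=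
  sys.b k ⬝ᵥ Pi (k + 1) *ᵥ sys.b k + sys.σ k ⬝ᵥ P (k + 1) *ᵥ sys.σ k
    + 2 * (y ⬝ᵥ sys.b k) + 2 * (κ ⬝ᵥ sys.σ k)
    - ∫ ω, r ω ⬝ᵥ mpInv (Ups sys P k) *ᵥ r ω ∂μ
    - meanWeightControl sys w μ P Pi k y κ ⬝ᵥ
      mpInv (UpsBar sys P Pi k) *ᵥ meanWeightControl sys w μ P Pi k y κ

/-- One step of the dynamic programming recursion. -/
theorem valueFn_nextState_add_runCost_eq {N : ℕ} (hG : IsGRESolution sys P Pi N) (hk : k < N)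
    (hΥ : (Ups sys P k).PosDef) (hΥb : (UpsBar sys P Pi k).PosDef)
    (hZ : IsUnitNoise μ F Z) (hw : MemLp (w.q k) 2 μ) (hwb : MemLp (w.qbar k) 2 μ)
    (hρ : MemLp (w.ρ k) 2 μ) (hρb : MemLp (w.ρbar k) 2 μ)
    {Y h : Ω → Fin n → ℝ} {r : Ω → Fin m → ℝ} {κ y : Fin n → ℝ}
    (hh : MemLp h 2 μ) (hr : MemLp r 2 μ)
    (hadj : IsAdjointStep sys w μ F Z k Y h r κ) (hX : SqAdapted μ F X) (hU : SqAdapted μ F U) :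
    valueFn μ (P (k + 1)) (Pi (k + 1)) Y y (nextState sys μ k Z X U) + runCost sys w μ k X U
    = valueFn μ (P k) (Pi k) (nextWeight sys P k h r)
        (meanWeightState sys w μ P Pi k y κ - (HBar sys P Pi k)ᵀ *ᵥ
          (mpInv (UpsBar sys P Pi k) *ᵥ meanWeightControl sys w μ P Pi k y κ)) X
      + excess sys μ P Pi k r (meanWeightControl sys w μ P Pi k y κ) X U
      + stepConst sys w μ P Pi k r y κ := by
  obtain ⟨hP, hPi⟩ := hG.isSymm (k + 1) hk
  have hs := ups_isSymm (sys := sys) (k := k) hP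
  have hsb := upsBar_isSymm (sys := sys) (k := k) hP hPi
  rw [valueFn_nextState_add_runCost hP hPi hZ hw hwb hρ hρb hh hr hadj hX hU,
    -- The square is completed twice: here for the deterministic mean, and below pointwise under the
    -- integral for the centred part.
    complete_square hsb (mpInv_isSymm hsb) (mul_mpInv_of_posDef hΥb)]
  simp only [complete_square hs (mpInv_isSymm hs) (mul_mpInv_of_posDef hΥ)]
  rw [← hG.step_P k hk, ← hG.step_Pi k hk]
  have hXm := memLp_centred hX.2
  have hY : MemLp (nextWeight sys P k h r) 2 μ := hh.sub (memLp_mulVec _ (memLp_mulVec _ hr))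
  have hgap := memLp_centredGap (sys := sys) (k := k) (P := P) hr hX.2 hU.2
  have key := (((HasInt.of_integrable (integrable_bilin (P k) hXm hXm)).add
    (HasInt.of_integrable (integrable_bilin (Ups sys P k) hgap hgap))).add
    ((HasInt.of_integrable (integrable_dotProduct hY hXm)).const_mul 2)).sub
    (HasInt.of_integrable (integrable_bilin (mpInv (Ups sys P k)) hr hr))
  have key2 := key.2
  simp only [centredGap, nextWeight] at key2
  rw [key2]
  simp only [valueFn, excess, stepConst, centredGap, meanGap, nextWeight]
  ring

end OneStep

/-! ### State process and total cost -/

section Dynamics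

/-- A filtration on `{l, …, N}` to which the noise is adapted and for which it is a martingale
difference sequence with unit conditional variances. -/
structure NoiseFiltration {Ω : Type*} {m0 : MeasurableSpace Ω} (μ : Measure Ω) (N : ℕ)
    (W : ℕ → Ω → ℝ) (l : ℕ) (F : ℕ → MeasurableSpace Ω) : Prop where
  noise : ∀ k, l ≤ k → k < N → IsUnitNoise μ (F k) (W k)
  mono : ∀ k, l ≤ k → k < N → F k ≤ F (k + 1)
  measurable : ∀ k, l ≤ k → k < N → Measurable[F (k + 1)] (W k)

variable {Ω : Type*} {G : MeasurableSpace Ω} [m0 : MeasurableSpace Ω] {n m : ℕ} {μ : Measure Ω}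
  {N l : ℕ}
  {W : ℕ → Ω → ℝ} {F : ℕ → MeasurableSpace Ω}
  {sys : System n m} {w : RandomWeights Ω n m}
  {x₀ : Ω → Fin n → ℝ} {u : ℕ → Ω → Fin m → ℝ}

theorem state_of_le {k : ℕ} (hk : k ≤ l) : state sys μ W l x₀ u k = x₀ := by
  cases k with
  | zero => rfl
  | succ k => rw [state, if_pos hk]

theorem state_succ {k : ℕ} (hk : l ≤ k) :
    state sys μ W l x₀ u (k + 1) = nextState sys μ k (W k) (state sys μ W l x₀ u k) (u k) := by
  rw [state, if_neg (by omega)]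
  rfl

/-- Every feedback law is realized by a control process. -/
theorem exists_closedLoop (sys : System n m) (μ : Measure Ω) (W : ℕ → Ω → ℝ) (l : ℕ)
    (x₀ : Ω → Fin n → ℝ) (φ : ℕ → (Fin n → ℝ) → (Fin n → ℝ) → Ω → Fin m → ℝ) :
    ∃ u : ℕ → Ω → Fin m → ℝ, ∀ k ω,
      u k ω = φ k (state sys μ W l x₀ u k ω) (∫ ω', state sys μ W l x₀ u k ω' ∂μ) ω := by
  -- The closed-loop trajectory is built first by recursion and the control is read off from it,
  -- which removes the circular dependence between the two.
  let x : ℕ → Ω → Fin n → ℝ := fun k => Nat.rec x₀ (fun k y => if k + 1 ≤ l then x₀ else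
    nextState sys μ k (W k) y fun ω => φ k (y ω) (∫ ω', y ω' ∂μ) ω) k
  let u : ℕ → Ω → Fin m → ℝ := fun k ω => φ k (x k ω) (∫ ω', x k ω' ∂μ) ω
  have hx : ∀ k, state sys μ W l x₀ u k = x k := by
    intro k
    induction k with
    | zero => rfl
    | succ k ih =>
      have e : x (k + 1) = if k + 1 ≤ l then x₀ else nextState sys μ k (W k) (x k) (u k) := rfl
      rw [e]
      split_ifs with h
      · exact state_of_le h
      · rw [state_succ (by omega), ih]
  exact ⟨u, fun k ω => by rw [hx]⟩

/-- The state depends on the control only up to almost sure equality. -/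
theorem state_congr {v : ℕ → Ω → Fin m → ℝ} {k : ℕ} (hlk : l ≤ k)
    (h : ∀ j, l ≤ j → j < k → v j =ᵐ[μ] u j) :
    state sys μ W l x₀ v k =ᵐ[μ] state sys μ W l x₀ u k := by
  induction k, hlk using Nat.le_induction with
  | base => rw [state_of_le le_rfl, state_of_le le_rfl]
  | succ k hk ih =>
    have hx := ih fun j h1 h2 => h j h1 (by omega)
    have hv := h k hk (by omega)
    rw [state_succ hk, state_succ hk]
    filter_upwards [hx, hv] with ω h1 h2
    simp only [nextState, h1, h2, integral_congr_ae hx, integral_congr_ae hv]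

variable [IsProbabilityMeasure μ]

theorem NoiseFiltration.sqAdapted_state (hF : NoiseFiltration μ N W l F)
    (hx₀ : SqAdapted μ (F l) x₀) {k : ℕ} (hlk : l ≤ k) (hkN : k ≤ N)
    (hu : ∀ j, l ≤ j → j < k → SqAdapted μ (F j) (u j)) :
    SqAdapted μ (F k) (state sys μ W l x₀ u k) := by
  induction k, hlk using Nat.le_induction with
  | base => rw [state_of_le le_rfl]; exact hx₀
  | succ k hk ih =>
    rw [state_succ hk]
    exact sqAdapted_nextState (hF.noise k hk hkN) (hF.mono k hk hkN) (hF.measurable k hk hkN)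
      (ih (by omega) fun j h1 h2 => hu j h1 (by omega)) (hu k hk (by omega))

theorem SqAdapted.linearFeedback {P Pi : ℕ → Matrix (Fin n) (Fin n) ℝ}
    {k : ℕ} {X : Ω → Fin n → ℝ} (hX : SqAdapted μ G X) :
    SqAdapted μ G fun ω => linearFeedback sys P Pi k (X ω) (∫ ω', X ω' ∂μ) :=
  ((hX.centred.mulVec _).mulVec _).neg.sub (SqAdapted.const _)

/-- Strong induction resolves the mutual dependence: the control at time `k` uses the state at `k`,
which uses only earlier controls. -/
theorem NoiseFiltration.sqAdapted_of_feedback (hF : NoiseFiltration μ N W l F)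
    (hx₀ : SqAdapted μ (F l) x₀) {P Pi : ℕ → Matrix (Fin n) (Fin n) ℝ} {s : ℕ → Ω → Fin m → ℝ}
    (hs : ∀ k, l ≤ k → k < N → SqAdapted μ (F k) (s k))
    (hu : ∀ k, l ≤ k → k < N → ∀ ω, u k ω = linearFeedback sys P Pi k (state sys μ W l x₀ u k ω)
      (∫ ω', state sys μ W l x₀ u k ω' ∂μ) + s k ω) :
    ∀ k, l ≤ k → k < N → SqAdapted μ (F k) (u k) := by
  intro k
  induction k using Nat.strong_induction_on with
  | _ k ih =>
    intro hlk hkN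
    have hx := hF.sqAdapted_state (sys := sys) hx₀ hlk hkN.le
      fun j h1 h2 => ih j h2 h1 (by omega)
    have e : u k = fun ω => linearFeedback sys P Pi k (state sys μ W l x₀ u k ω)
      (∫ ω', state sys μ W l x₀ u k ω' ∂μ) + s k ω := funext (hu k hlk hkN)
    rw [e]
    exact hx.linearFeedback.add (hs k hlk hkN)

/-- The total cost as terminal value plus running costs. -/
theorem cost_eq (hF : NoiseFiltration μ N W l F) (hx₀ : SqAdapted μ (F l) x₀) (hl : l ≤ N)
    (hw : w.SquareIntegrable μ N) (hu : ∀ k, l ≤ k → k < N → SqAdapted μ (F k) (u k)) :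
    cost sys w μ N W l x₀ u
      = valueFn μ sys.G (sys.G + sys.Gbar) (centred μ w.g) (∫ ω, w.g ω ∂μ + ∫ ω, w.gbar ω ∂μ)
          (state sys μ W l x₀ u N)
        + ∑ k ∈ Finset.Ico l N, runCost sys w μ k (state sys μ W l x₀ u k) (u k) := by
  have hx : ∀ k, l ≤ k → k ≤ N → MemLp (state sys μ W l x₀ u k) 2 μ := fun k h1 h2 =>
    (hF.sqAdapted_state hx₀ h1 h2 fun j h3 h4 => hu j h3 (by omega)).2
  have hxN := hx N hl le_rfl
  have hrun : ∀ k ∈ Finset.Ico l N, HasInt μ _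
      (runCost sys w μ k (state sys μ W l x₀ u k) (u k)) := fun k hk => by
    obtain ⟨h1, h2⟩ := Finset.mem_Ico.1 hk
    exact ⟨(runCost_eq (sys := sys) (hw.q k h2) (hw.qbar k h2) (hw.ρ k h2) (hw.ρbar k h2)
      (hx k h1 h2.le) (hu k h1 h2).2).1, rfl⟩
  have key := ((((HasInt.of_integrable (integrable_bilin sys.G hxN hxN)).add
    ((HasInt.of_integrable (integrable_dotProduct hw.g hxN)).const_mul 2)).add
    (HasInt.const (μ := μ) ((∫ ω, state sys μ W l x₀ u N ω ∂μ) ⬝ᵥ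
      sys.Gbar *ᵥ (∫ ω, state sys μ W l x₀ u N ω ∂μ)))).add
    ((HasInt.of_integrable (integrable_dotProduct hw.gbar
      (memLp_const (∫ ω, state sys μ W l x₀ u N ω ∂μ)))).const_mul 2)).add
    (HasInt.sum (Finset.Ico l N) hrun)
  refine key.2.trans ?_
  rw [integral_bilin_eq _ hxN hxN, integral_dotProduct_eq hw.g hxN,
    integral_dotProduct_const (hw.gbar.integrable one_le_two), valueFn]
  simp only [add_mulVec, dotProduct_add, add_dotProduct]
  ring

variable {P Pi : ℕ → Matrix (Fin n) (Fin n) ℝ}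

/-- Backward processes that carry the linear weights of the cost from time `N` to time `l`. -/
structure AdjointFamily {Ω : Type*} {m0 : MeasurableSpace Ω} {n m : ℕ} (sys : System n m)
    (w : RandomWeights Ω n m) (μ : Measure Ω) (P Pi : ℕ → Matrix (Fin n) (Fin n) ℝ)
    (W : ℕ → Ω → ℝ) (F : ℕ → MeasurableSpace Ω) (l N : ℕ) (Y h : ℕ → Ω → Fin n → ℝ)
    (r : ℕ → Ω → Fin m → ℝ) (y κ : ℕ → Fin n → ℝ) : Prop where
  terminal_Y : Y N = centred μ w.g
  terminal_y : y N = ∫ ω, w.g ω ∂μ + ∫ ω, w.gbar ω ∂μ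
  memLp_h : ∀ k, l ≤ k → k < N → MemLp (h k) 2 μ
  adapted_r : ∀ k, l ≤ k → k < N → SqAdapted μ (F k) (r k)
  integral_r : ∀ k, l ≤ k → k < N → ∫ ω, r k ω ∂μ = 0
  adjoint : ∀ k, l ≤ k → k < N → IsAdjointStep sys w μ (F k) (W k) k (Y (k + 1)) (h k) (r k) (κ k)
  step_Y : ∀ k, l ≤ k → k < N → Y k = nextWeight sys P k (h k) (r k)
  step_y : ∀ k, l ≤ k → k < N → y k = meanWeightState sys w μ P Pi k (y (k + 1)) (κ k)
    - (HBar sys P Pi k)ᵀ *ᵥ (mpInv (UpsBar sys P Pi k) *ᵥ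
        meanWeightControl sys w μ P Pi k (y (k + 1)) (κ k))

variable {Y h : ℕ → Ω → Fin n → ℝ} {r : ℕ → Ω → Fin m → ℝ} {y κ : ℕ → Fin n → ℝ}

/-- The dynamic programming recursion. -/
theorem AdjointFamily.tail_cost_eq (hA : AdjointFamily sys w μ P Pi W F l N Y h r y κ)
    (hl : l ≤ N) (hG : IsGRESolution sys P Pi N)
    (hΥ : ∀ k, l ≤ k → k < N → (Ups sys P k).PosDef ∧ (UpsBar sys P Pi k).PosDef)
    (hF : ∀ k, l ≤ k → k < N → IsUnitNoise μ (F k) (W k)) (hw : w.SquareIntegrable μ N)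
    {x : ℕ → Ω → Fin n → ℝ} (hx : ∀ k, l ≤ k → k < N → SqAdapted μ (F k) (x k))
    (hu : ∀ k, l ≤ k → k < N → SqAdapted μ (F k) (u k))
    (hstep : ∀ k, l ≤ k → k < N → x (k + 1) = nextState sys μ k (W k) (x k) (u k)) :
    valueFn μ sys.G (sys.G + sys.Gbar) (centred μ w.g) (∫ ω, w.g ω ∂μ + ∫ ω, w.gbar ω ∂μ) (x N)
        + ∑ k ∈ Finset.Ico l N, runCost sys w μ k (x k) (u k)
      = valueFn μ (P l) (Pi l) (Y l) (y l) (x l)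
        + ∑ k ∈ Finset.Ico l N,
          (excess sys μ P Pi k (r k) (meanWeightControl sys w μ P Pi k (y (k + 1)) (κ k))
              (x k) (u k)
            + stepConst sys w μ P Pi k (r k) (y (k + 1)) (κ k)) := by
  rw [← hG.terminal_Pi, ← hG.terminal_P, ← hA.terminal_Y, ← hA.terminal_y]
  -- The one-step identities telescope forward, with the value function at the intermediate time `M`
  -- as terminal cost.
  have main : ∀ M, l ≤ M → M ≤ N →
      valueFn μ (P M) (Pi M) (Y M) (y M) (x M)
        + ∑ k ∈ Finset.Ico l M, runCost sys w μ k (x k) (u k)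
      = valueFn μ (P l) (Pi l) (Y l) (y l) (x l)
        + ∑ k ∈ Finset.Ico l M,
          (excess sys μ P Pi k (r k) (meanWeightControl sys w μ P Pi k (y (k + 1)) (κ k))
              (x k) (u k)
            + stepConst sys w μ P Pi k (r k) (y (k + 1)) (κ k)) := by
    intro M hM
    induction M, hM using Nat.le_induction with
    | base => simp
    | succ k hk ih =>
      intro hkN
      have hs := valueFn_nextState_add_runCost_eq hG hkN (hΥ k hk hkN).1 (hΥ k hk hkN).2
        (hF k hk hkN) (hw.q k hkN) (hw.qbar k hkN) (hw.ρ k hkN) (hw.ρbar k hkN)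
        (y := y (k + 1)) (hA.memLp_h k hk hkN) (hA.adapted_r k hk hkN).2 (hA.adjoint k hk hkN)
        (hx k hk hkN) (hu k hk hkN)
      rw [← hA.step_Y k hk hkN, ← hA.step_y k hk hkN, ← hstep k hk hkN] at hs
      rw [Finset.sum_Ico_succ_top hk, Finset.sum_Ico_succ_top hk]
      have := ih (by omega)
      linarith
  exact main N hl le_rfl

/-! ### Existence of the adjoint processes -/

/-- With `p = 𝔼[Y | G]` and `θ = 𝔼[Y Z | G]`, transposing the coefficients gives `h = A'p + C'θ + (q
- 𝔼q)`, and `κ = 𝔼θ`. The weight `r` enters the control, so `ρ` must be projected onto the available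
information, whereas `q` need not be. Centring `r` costs nothing because it is tested only on
controls of mean zero. -/
theorem IsUnitNoise.exists_isAdjointStep {Z : Ω → ℝ} {k : ℕ}
    (hZ : IsUnitNoise μ G Z) (hq : MemLp (w.q k) 2 μ) (hρ : MemLp (w.ρ k) 2 μ)
    {Y : Ω → Fin n → ℝ} (hY : MemLp Y 2 μ) :
    ∃ (h : Ω → Fin n → ℝ) (r : Ω → Fin m → ℝ) (κ : Fin n → ℝ), MemLp h 2 μ ∧
      SqAdapted μ G r ∧ ∫ ω, r ω ∂μ = 0 ∧ IsAdjointStep sys w μ G Z k Y h r κ := by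
  obtain ⟨p, hp, hpY⟩ := exists_sqAdapted_integral_dotProduct hZ.le hY
  obtain ⟨θ, hθ, hθY⟩ := hZ.exists_sqAdapted_integral_smul hY
  obtain ⟨ρ', hρ', hρY⟩ := exists_sqAdapted_integral_dotProduct hZ.le (memLp_centred hρ)
  have hr : SqAdapted μ G fun ω => (sys.B k)ᵀ *ᵥ p ω + (sys.D k)ᵀ *ᵥ θ ω + ρ' ω :=
    ((hp.mulVec _).add (hθ.mulVec _)).add hρ'
  have hh : MemLp (fun ω => (sys.A k)ᵀ *ᵥ p ω + (sys.C k)ᵀ *ᵥ θ ω + centred μ (w.q k) ω) 2 μ :=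
    ((hp.mulVec _).add (hθ.mulVec _)).2.add (memLp_centred hq)
  refine ⟨_, _, ∫ ω, θ ω ∂μ, hh, hr.centred, integral_centred hr.integrable, ?_⟩
  intro X U c hX hU hX0 hU0
  have tr : ∀ {a b : ℕ} (M : Matrix (Fin a) (Fin b) ℝ) (p : Fin a → ℝ) (z : Fin b → ℝ),
      (Mᵀ *ᵥ p) ⬝ᵥ z = p ⬝ᵥ M *ᵥ z := by
    intro a b M p z
    rw [dotProduct_mulVec_comm, dotProduct_comm]
  have hab : SqAdapted μ G fun ω => sys.A k *ᵥ X ω + sys.B k *ᵥ U ω :=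
    (hX.mulVec _).add (hU.mulVec _)
  have hcd : SqAdapted μ G fun ω => sys.C k *ᵥ X ω + sys.D k *ᵥ U ω + c :=
    ((hX.mulVec _).add (hU.mulVec _)).add (SqAdapted.const _)
  have e₁ : ∫ ω, Y ω ⬝ᵥ (sys.A k *ᵥ X ω + sys.B k *ᵥ U ω
        + Z ω • (sys.C k *ᵥ X ω + sys.D k *ᵥ U ω + c)) ∂μ
      = ∫ ω, p ω ⬝ᵥ (sys.A k *ᵥ X ω + sys.B k *ᵥ U ω) ∂μ
        + ∫ ω, θ ω ⬝ᵥ (sys.C k *ᵥ X ω + sys.D k *ᵥ U ω + c) ∂μ := by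
    rw [← hpY _ hab, ← hθY _ hcd, ← integral_add (integrable_dotProduct hY hab.2)
      (integrable_dotProduct hY (hZ.memLp_smul hcd))]
    simp only [dotProduct_add]
  have e₂ := ((HasInt.of_integrable (integrable_bilin (sys.A k) hp.2 hX.2)).add
    (HasInt.of_integrable (integrable_bilin (sys.B k) hp.2 hU.2))).2
  have e₃ := (((HasInt.of_integrable (integrable_bilin (sys.C k) hθ.2 hX.2)).add
    (HasInt.of_integrable (integrable_bilin (sys.D k) hθ.2 hU.2))).add
    ⟨integrable_dotProduct hθ.2 (memLp_const c), integral_dotProduct_const hθ.integrable c⟩).2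
  have e₄ := (((HasInt.of_integrable (integrable_bilin (sys.A k) hp.2 hX.2)).add
    (HasInt.of_integrable (integrable_bilin (sys.C k) hθ.2 hX.2))).add
    (HasInt.of_integrable (integrable_dotProduct (memLp_centred hq) hX.2))).2
  have e₅ := (((HasInt.of_integrable (integrable_bilin (sys.B k) hp.2 hU.2)).add
    (HasInt.of_integrable (integrable_bilin (sys.D k) hθ.2 hU.2))).add
    (HasInt.of_integrable (integrable_dotProduct hρ'.2 hU.2))).2
  have e₆ : ∫ ω, centred μ (fun ω => (sys.B k)ᵀ *ᵥ p ω + (sys.D k)ᵀ *ᵥ θ ω + ρ' ω) ω ⬝ᵥ U ω ∂μ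
      = ∫ ω, ((sys.B k)ᵀ *ᵥ p ω + (sys.D k)ᵀ *ᵥ θ ω + ρ' ω) ⬝ᵥ U ω ∂μ := by
    have : centred μ U = U := by funext ω; simp [centred, hU0]
    rw [integral_dotProduct_eq hr.2 hU.2, hU0, dotProduct_zero, add_zero, this]
  rw [e₁, e₆, hρY _ hU]
  simp only [dotProduct_add, add_dotProduct, tr]
  linarith

theorem NoiseFiltration.exists_adjointFamily (hF : NoiseFiltration μ N W l F)
    (hw : w.SquareIntegrable μ N) :
    ∃ Y h r y κ, AdjointFamily sys w μ P Pi W F l N Y h r y κ := by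
  have hstep : ∀ k < N, ∀ Y : Ω → Fin n → ℝ, MemLp Y 2 μ → ∃ Y' : Ω → Fin n → ℝ, MemLp Y' 2 μ ∧
      (l ≤ k → ∃ (h : Ω → Fin n → ℝ) (r : Ω → Fin m → ℝ) (κ : Fin n → ℝ), MemLp h 2 μ ∧
        SqAdapted μ (F k) r ∧ ∫ ω, r ω ∂μ = 0 ∧ IsAdjointStep sys w μ (F k) (W k) k Y h r κ ∧
        Y' = nextWeight sys P k h r) := by
    intro k hk Y hY
    by_cases hlk : l ≤ k
    · obtain ⟨h, r, κ, hh, hr, hr0, hadj⟩ :=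
        (hF.noise k hlk hk).exists_isAdjointStep (sys := sys) (hw.q k hk) (hw.ρ k hk) hY
      exact ⟨_, hh.sub (memLp_mulVec _ (memLp_mulVec _ hr.2)),
        fun _ => ⟨h, r, κ, hh, hr, hr0, hadj, rfl⟩⟩
    -- Nothing is known about the noise before time `l`; the recursion is continued by a dummy step
    -- down to time `0`.
    · exact ⟨Y, hY, fun h => absurd h hlk⟩
  obtain ⟨Y, hYN, -, hY⟩ := exists_backward N (fun Y : Ω → Fin n → ℝ => MemLp Y 2 μ) _
    (centred μ w.g) (memLp_centred hw.g) hstep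
  have hY' : ∀ k, ∃ (h : Ω → Fin n → ℝ) (r : Ω → Fin m → ℝ) (κ : Fin n → ℝ), l ≤ k → k < N →
      MemLp h 2 μ ∧ SqAdapted μ (F k) r ∧ ∫ ω, r ω ∂μ = 0 ∧
      IsAdjointStep sys w μ (F k) (W k) k (Y (k + 1)) h r κ ∧ Y k = nextWeight sys P k h r := by
    intro k
    by_cases hk : l ≤ k ∧ k < N
    · obtain ⟨h, r, κ, H⟩ := hY k hk.2 hk.1
      exact ⟨h, r, κ, fun _ _ => H⟩
    · exact ⟨0, 0, 0, fun h1 h2 => absurd ⟨h1, h2⟩ hk⟩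
  choose h r κ H using hY'
  -- The mean weights come second because their recursion needs the vectors `κ` produced by the
  -- random one.
  obtain ⟨y, hyN, -, hy⟩ := exists_backward (α := Fin n → ℝ) N (fun _ => True)
    (fun k x z => z = meanWeightState sys w μ P Pi k x (κ k)
      - (HBar sys P Pi k)ᵀ *ᵥ (mpInv (UpsBar sys P Pi k) *ᵥ
        meanWeightControl sys w μ P Pi k x (κ k)))
    (∫ ω, w.g ω ∂μ + ∫ ω, w.gbar ω ∂μ) trivial (fun k _ x _ => ⟨_, trivial, rfl⟩)
  exact ⟨Y, h, r, y, κ, hYN, hyN, fun k h1 h2 => (H k h1 h2).1, fun k h1 h2 => (H k h1 h2).2.1,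
    fun k h1 h2 => (H k h1 h2).2.2.1, fun k h1 h2 => (H k h1 h2).2.2.2.1,
    fun k h1 h2 => (H k h1 h2).2.2.2.2, fun k _ h2 => hy k h2⟩

theorem meanWeightControl_toRandom (d : Weights n m) (k : ℕ) (η : ℕ → Fin n → ℝ) :
    meanWeightControl sys (d.toRandom Ω) μ P Pi k (η (k + 1)) 0 = zeta sys d P Pi η k := by
  simp [meanWeightControl, zeta, Weights.toRandom, add_assoc]

/-- Deterministic weights have no centred part, so every random adjoint object and every `κ` can be
zero, and the recursion left for `y` is that of `η`. -/
theorem IsLRESolution.adjointFamily {d : Weights n m} {η : ℕ → Fin n → ℝ}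
    (hη : IsLRESolution sys d P Pi η N) :
    AdjointFamily sys (d.toRandom Ω) μ P Pi W F l N (fun _ _ => 0) (fun _ _ => 0) (fun _ _ => 0)
      η (fun _ => 0) where
  terminal_Y := (centred_const _).symm
  terminal_y := by rw [hη.terminal]; simp [Weights.toRandom]
  memLp_h _ _ _ := memLp_const _
  adapted_r _ _ _ := SqAdapted.const _
  integral_r _ _ _ := by simp
  adjoint k _ _ X U c _ _ _ _ := by
    have e₁ : centred μ ((d.toRandom Ω).q k) = fun _ => 0 := centred_const _
    have e₂ : centred μ ((d.toRandom Ω).ρ k) = fun _ => 0 := centred_const _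
    simp [e₁, e₂]
  step_Y k _ _ := by funext ω; simp [nextWeight]
  step_y k _ hk := by
    rw [hη.step k hk, meanWeightControl_toRandom]
    simp only [meanWeightState, Weights.toRandom, integral_const, probReal_univ, one_smul,
      add_zero]
    abel

theorem Weights.toRandom_squareIntegrable (d : Weights n m) :
    (d.toRandom Ω).SquareIntegrable μ N :=
  ⟨memLp_const _, memLp_const _, fun _ _ => memLp_const _, fun _ _ => memLp_const _,
    fun _ _ => memLp_const _, fun _ _ => memLp_const _⟩

end Dynamics

/-! ### Optimality -/

section Optimality

theorem history_mono {Ω : Type*} {n l : ℕ} {W : ℕ → Ω → ℝ} {ξ : Ω → Fin n → ℝ} {k k' : ℕ} (h : k ≤ k') :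
    history W l ξ k ≤ history W l ξ k' :=
  sup_le_sup_left (biSup_mono fun _ hj => ⟨hj.1, hj.2.trans_le h⟩) _

variable {Ω : Type*} {G : MeasurableSpace Ω} [m0 : MeasurableSpace Ω] {n m : ℕ} {μ : Measure Ω}
  {N l : ℕ} {W : ℕ → Ω → ℝ} {sys : System n m} {w : RandomWeights Ω n m} {ξ : Ω → Fin n → ℝ}
  {P Pi : ℕ → Matrix (Fin n) (Fin n) ℝ}

theorem IsInitialState.noiseFiltration (hξ : IsInitialState μ N W l ξ)
    (hW : ∀ k < N, Measurable (W k)) : NoiseFiltration μ N W l (history W l ξ) where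
  noise k hl hk :=
    { le := sup_le hξ.measurable.comap_le
        (iSup₂_le fun j hj => (hW j (hj.2.trans hk)).comap_le)
      measurable := hW k hk
      mean_zero := hξ.mean_zero k hl hk
      unit_variance := hξ.unit_variance k hl hk }
  mono k _ _ := history_mono k.le_succ
  measurable k hl _ := (comap_measurable (W k)).mono
    (le_sup_of_le_right (le_iSup₂_of_le (f := fun j (_ : j ∈ Set.Ico l (k + 1)) =>
      MeasurableSpace.comap (W j) inferInstance) k ⟨hl, k.lt_succ_self⟩ le_rfl)) le_rfl

theorem IsInitialState.sqAdapted (hξ : IsInitialState μ N W l ξ) :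
    SqAdapted μ (history W l ξ l) ξ :=
  ⟨(comap_measurable ξ).mono le_sup_left le_rfl, hξ.memLp⟩

theorem quadratic_nonneg {a : ℕ} {M : Matrix (Fin a) (Fin a) ℝ} (hM : M.PosSemidef)
    (z : Fin a → ℝ) : 0 ≤ z ⬝ᵥ M *ᵥ z := by
  simpa using hM.dotProduct_mulVec_nonneg z

theorem quadratic_eq_zero {a : ℕ} {M : Matrix (Fin a) (Fin a) ℝ} (hM : M.PosDef)
    {z : Fin a → ℝ} (hz : z ⬝ᵥ M *ᵥ z = 0) : z = 0 := by
  by_contra h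
  have := hM.dotProduct_mulVec_pos h
  simp only [star_trivial] at this
  exact this.ne' hz

variable {k : ℕ} {r : Ω → Fin m → ℝ} {s : Fin m → ℝ} {X : Ω → Fin n → ℝ} {U : Ω → Fin m → ℝ}

theorem excess_nonneg (hΥ : (Ups sys P k).PosDef) (hΥb : (UpsBar sys P Pi k).PosDef) :
    0 ≤ excess sys μ P Pi k r s X U :=
  add_nonneg (integral_nonneg fun _ => quadratic_nonneg hΥ.posSemidef _)
    (quadratic_nonneg hΥb.posSemidef _)

variable [IsProbabilityMeasure μ]

/-- The excess cost vanishes exactly for the optimal feedback. -/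
theorem feedback_of_excess_eq_zero (hΥ : (Ups sys P k).PosDef) (hΥb : (UpsBar sys P Pi k).PosDef)
    (hr : MemLp r 2 μ) (hX : MemLp X 2 μ) (hU : MemLp U 2 μ)
    (h : excess sys μ P Pi k r s X U = 0) :
    ∀ᵐ ω ∂μ, U ω = linearFeedback sys P Pi k (X ω) (∫ ω, X ω ∂μ)
      + (-(mpInv (Ups sys P k) *ᵥ r ω) - mpInv (UpsBar sys P Pi k) *ᵥ s) := by
  have hgap := memLp_centredGap (sys := sys) (k := k) (P := P) hr hX hU
  have h1 : 0 ≤ ∫ ω, centredGap sys μ P k r X U ω ⬝ᵥ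
      Ups sys P k *ᵥ centredGap sys μ P k r X U ω ∂μ :=
    integral_nonneg fun _ => quadratic_nonneg hΥ.posSemidef _
  have h2 := quadratic_nonneg hΥb.posSemidef
    (meanGap sys P Pi k s (∫ ω, X ω ∂μ) (∫ ω, U ω ∂μ))
  rw [excess] at h
  have e2 := quadratic_eq_zero hΥb
    (z := meanGap sys P Pi k s (∫ ω, X ω ∂μ) (∫ ω, U ω ∂μ)) (by linarith)
  have e1 := (integral_eq_zero_iff_of_nonneg
    (fun _ => quadratic_nonneg hΥ.posSemidef _) (integrable_bilin _ hgap hgap)).1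
    (by linarith : ∫ ω, centredGap sys μ P k r X U ω ⬝ᵥ
      Ups sys P k *ᵥ centredGap sys μ P k r X U ω ∂μ = 0)
  filter_upwards [e1] with ω hω
  have e3 := quadratic_eq_zero hΥ hω
  rw [meanGap, add_eq_zero_iff_eq_neg] at e2
  simp only [centredGap, centred] at e3
  rw [add_eq_zero_iff_eq_neg, sub_eq_iff_eq_add, e2] at e3
  rw [e3, linearFeedback]
  simp only [mulVec_add]
  abel

/-- Since `r` is centred, the first feedback term integrates to zero; hence the mean of `U` is the
optimal mean control, and both deviations vanish. Positivity of the Riccati forms plays no role in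
this direction. -/
theorem excess_eq_zero_of_feedback (hr : SqAdapted μ G r) (hr0 : ∫ ω, r ω ∂μ = 0)
    (hX : SqAdapted μ G X)
    (h : ∀ ω, U ω = linearFeedback sys P Pi k (X ω) (∫ ω, X ω ∂μ)
      + (-(mpInv (Ups sys P k) *ᵥ r ω) - mpInv (UpsBar sys P Pi k) *ᵥ s)) :
    excess sys μ P Pi k r s X U = 0 := by
  have hU : ∀ ω, U ω = -(mpInv (Ups sys P k) *ᵥ (Hmat sys P k *ᵥ centred μ X ω + r ω))
      - mpInv (UpsBar sys P Pi k) *ᵥ (HBar sys P Pi k *ᵥ (∫ ω, X ω ∂μ) + s) := fun ω => by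
    rw [h ω, linearFeedback]
    simp only [mulVec_add, centred]
    abel
  have hv : SqAdapted μ G fun ω => Hmat sys P k *ᵥ centred μ X ω + r ω :=
    (hX.centred.mulVec _).add hr
  have hv0 : ∫ ω, Hmat sys P k *ᵥ centred μ X ω + r ω ∂μ = 0 := by
    rw [integral_add (hX.centred.mulVec _).integrable hr.integrable, hr0,
      integral_mulVec _ hX.centred.integrable, integral_centred hX.integrable]
    simp
  have hm : ∫ ω, U ω ∂μ
      = -(mpInv (UpsBar sys P Pi k) *ᵥ (HBar sys P Pi k *ᵥ (∫ ω, X ω ∂μ) + s)) := by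
    simp only [hU]
    rw [integral_sub (hv.mulVec _).neg.integrable (integrable_const _), integral_neg,
      integral_mulVec _ hv.integrable, hv0]
    simp
  have e1 : ∀ ω, centredGap sys μ P k r X U ω = 0 := fun ω => by
    rw [centredGap, centred, hm, hU]
    abel
  have e2 : meanGap sys P Pi k s (∫ ω, X ω ∂μ) (∫ ω, U ω ∂μ) = 0 := by
    rw [meanGap, hm]
    abel
  simp [excess, e1, e2]

variable {Y h : ℕ → Ω → Fin n → ℝ} {r : ℕ → Ω → Fin m → ℝ} {y κ : ℕ → Fin n → ℝ}

/-- The feedback law built from the Riccati equations and the adjoint processes is the unique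
optimal control. -/
theorem AdjointFamily.isUniqueOpenLoopOptimal
    (hA : AdjointFamily sys w μ P Pi W (history W l ξ) l N Y h r y κ)
    (hl : l ≤ N) (hG : IsGRESolution sys P Pi N)
    (hΥ : ∀ k < N, (Ups sys P k).PosDef ∧ (UpsBar sys P Pi k).PosDef)
    (hW : ∀ k < N, Measurable (W k)) (hξ : IsInitialState μ N W l ξ)
    (hw : w.SquareIntegrable μ N) {u : ℕ → Ω → Fin m → ℝ}
    (hu : ∀ k, l ≤ k → k < N → ∀ ω, u k ω =
      linearFeedback sys P Pi k (state sys μ W l ξ u k ω) (∫ ω', state sys μ W l ξ u k ω' ∂μ)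
      + (-(mpInv (Ups sys P k) *ᵥ r k ω) - mpInv (UpsBar sys P Pi k) *ᵥ
          meanWeightControl sys w μ P Pi k (y (k + 1)) (κ k))) :
    IsUniqueOpenLoopOptimal sys w μ N W l ξ u := by
  have hF := hξ.noiseFiltration hW
  have hcost : ∀ v, Admissible μ N W l ξ v → cost sys w μ N W l ξ v
      = valueFn μ (P l) (Pi l) (Y l) (y l) ξ
        + (∑ k ∈ Finset.Ico l N, excess sys μ P Pi k (r k)
            (meanWeightControl sys w μ P Pi k (y (k + 1)) (κ k)) (state sys μ W l ξ v k) (v k)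
          + ∑ k ∈ Finset.Ico l N, stepConst sys w μ P Pi k (r k) (y (k + 1)) (κ k)) := by
    intro v hv
    have hx : ∀ k, l ≤ k → k < N → SqAdapted μ (history W l ξ k) (state sys μ W l ξ v k) :=
      fun k h1 h2 => hF.sqAdapted_state hξ.sqAdapted h1 h2.le fun j h3 h4 => hv j h3 (h4.trans h2)
    rw [cost_eq hF hξ.sqAdapted hl hw hv, hA.tail_cost_eq hl hG (fun k _ => hΥ k) hF.noise hw hx hv
      (fun k h1 _ => state_succ h1), state_of_le le_rfl, Finset.sum_add_distrib]
  have hadm : Admissible μ N W l ξ u := hF.sqAdapted_of_feedback (sys := sys) hξ.sqAdapted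
    (fun k h1 h2 => ((hA.adapted_r k h1 h2).mulVec _).neg.sub (SqAdapted.const _)) hu
  have hexu : ∀ k ∈ Finset.Ico l N, excess sys μ P Pi k (r k)
      (meanWeightControl sys w μ P Pi k (y (k + 1)) (κ k)) (state sys μ W l ξ u k) (u k) = 0 := by
    intro k hk
    obtain ⟨h1, h2⟩ := Finset.mem_Ico.1 hk
    exact excess_eq_zero_of_feedback (hA.adapted_r k h1 h2) (hA.integral_r k h1 h2)
      (hF.sqAdapted_state hξ.sqAdapted h1 h2.le fun j h3 h4 => hadm j h3 (h4.trans h2))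
      (hu k h1 h2)
  have hnn : ∀ v : ℕ → Ω → Fin m → ℝ, ∀ k ∈ Finset.Ico l N, 0 ≤ excess sys μ P Pi k (r k)
      (meanWeightControl sys w μ P Pi k (y (k + 1)) (κ k)) (state sys μ W l ξ v k) (v k) :=
    fun v k hk => excess_nonneg (hΥ k (Finset.mem_Ico.1 hk).2).1 (hΥ k (Finset.mem_Ico.1 hk).2).2
  refine ⟨⟨hadm, fun v hv => ?_⟩, fun v hv => ?_⟩
  · rw [hcost u hadm, hcost v hv, Finset.sum_eq_zero hexu]
    have := Finset.sum_nonneg (hnn v)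
    linarith
  · have hle := hv.2 u hadm
    rw [hcost u hadm, hcost v hv.1, Finset.sum_eq_zero hexu] at hle
    have hz : ∑ k ∈ Finset.Ico l N, excess sys μ P Pi k (r k)
        (meanWeightControl sys w μ P Pi k (y (k + 1)) (κ k)) (state sys μ W l ξ v k) (v k) = 0 :=
      le_antisymm (by linarith) (Finset.sum_nonneg (hnn v))
    rw [Finset.sum_eq_zero_iff_of_nonneg (hnn v)] at hz
    -- Zero excess only ties the control to its own state. Forward induction makes the two states
    -- agree almost surely up to time `k`, and then the common feedback law makes the controls
    -- agree.
    intro k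
    induction k using Nat.strong_induction_on with
    | _ k ih =>
      intro h1 h2
      have hx : state sys μ W l ξ v k =ᵐ[μ] state sys μ W l ξ u k :=
        state_congr h1 fun j h3 h4 => ih j h4 h3 (h4.trans h2)
      have hfb := feedback_of_excess_eq_zero (hΥ k h2).1 (hΥ k h2).2 (hA.adapted_r k h1 h2).2
        (hF.sqAdapted_state hξ.sqAdapted h1 h2.le fun j h3 h4 => hv.1 j h3 (h4.trans h2)).2
        (hv.1 k h1 h2).2 (hz k (Finset.mem_Ico.2 ⟨h1, h2⟩))
      filter_upwards [hfb, hx] with ω e1 e2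
      rw [e1, hu k h1 h2 ω, e2, integral_congr_ae hx]

/-- Unique solvability for square integrable random weights. -/
theorem exists_isUniqueOpenLoopOptimal (hl : l ≤ N) (hG : IsGRESolution sys P Pi N)
    (hΥ : ∀ k < N, (Ups sys P k).PosDef ∧ (UpsBar sys P Pi k).PosDef)
    (hW : ∀ k < N, Measurable (W k)) (hξ : IsInitialState μ N W l ξ)
    (hw : w.SquareIntegrable μ N) :
    ∃ u : ℕ → Ω → Fin m → ℝ, IsUniqueOpenLoopOptimal sys w μ N W l ξ u := by
  obtain ⟨Y, h, r, y, κ, hA⟩ :=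
    (hξ.noiseFiltration hW).exists_adjointFamily (sys := sys) (P := P) (Pi := Pi) hw
  obtain ⟨u, hu⟩ := exists_closedLoop sys μ W l ξ fun k x Ex ω => linearFeedback sys P Pi k x Ex
    + (-(mpInv (Ups sys P k) *ᵥ r k ω) - mpInv (UpsBar sys P Pi k) *ᵥ
          meanWeightControl sys w μ P Pi k (y (k + 1)) (κ k))
  exact ⟨u, hA.isUniqueOpenLoopOptimal hl hG hΥ hW hξ hw fun k _ _ ω => hu k ω⟩

/-- The optimal feedback for deterministic weights. -/
theorem IsLRESolution.exists_isUniqueOpenLoopOptimal {d : Weights n m} {η : ℕ → Fin n → ℝ}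
    (hη : IsLRESolution sys d P Pi η N) (hl : l ≤ N) (hG : IsGRESolution sys P Pi N)
    (hΥ : ∀ k < N, (Ups sys P k).PosDef ∧ (UpsBar sys P Pi k).PosDef)
    (hW : ∀ k < N, Measurable (W k)) (hξ : IsInitialState μ N W l ξ) :
    ∃ u : ℕ → Ω → Fin m → ℝ, IsUniqueOpenLoopOptimal sys (d.toRandom Ω) μ N W l ξ u ∧
      ∀ k ω, u k ω = linearFeedback sys P Pi k (state sys μ W l ξ u k ω)
          (∫ ω', state sys μ W l ξ u k ω' ∂μ)
        - mpInv (UpsBar sys P Pi k) *ᵥ zeta sys d P Pi η k := by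
  obtain ⟨u, hu⟩ := exists_closedLoop sys μ W l ξ fun k x Ex _ => linearFeedback sys P Pi k x Ex
    - mpInv (UpsBar sys P Pi k) *ᵥ zeta sys d P Pi η k
  refine ⟨u, hη.adjointFamily.isUniqueOpenLoopOptimal hl hG hΥ hW hξ
    d.toRandom_squareIntegrable fun k _ _ ω => ?_, hu⟩
  rw [hu k ω, meanWeightControl_toRandom]
  simp [sub_eq_add_neg]

end Optimality

/-! ### Strong regularity -/

section Regularity

variable {Ω : Type*} [m0 : MeasurableSpace Ω] {n m : ℕ} {μ : Measure Ω} {N : ℕ}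
  {W : ℕ → Ω → ℝ} {F : ℕ → MeasurableSpace Ω} {sys : System n m}
  {P Pi : ℕ → Matrix (Fin n) (Fin n) ℝ}

theorem memLp_smul_const {a : ℕ} {ψ : Ω → ℝ} (hψ : MemLp ψ 2 μ) (v : Fin a → ℝ) :
    MemLp (fun ω => ψ ω • v) 2 μ :=
  MemLp.of_eval fun i => by simpa using hψ.mul_const (v i)

variable [IsProbabilityMeasure μ]

/-- For a homogeneous system started at zero, the cost of the control that equals `ψ v` at
time `k`, vanishes before and follows the optimal feedback afterwards. -/
theorem exists_control_cost_eq (hF : NoiseFiltration μ N W 0 F)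
    (hb : ∀ k, sys.b k = 0 ∧ sys.σ k = 0) (hG : IsGRESolution sys P Pi N) {k : ℕ} (hk : k < N)
    (hΥ : ∀ j, k + 1 ≤ j → j < N → (Ups sys P j).PosDef ∧ (UpsBar sys P Pi j).PosDef)
    {ψ : Ω → ℝ} (hψ : Measurable[F k] ψ) (hψ2 : MemLp ψ 2 μ) (v : Fin m → ℝ) :
    ∃ u : ℕ → Ω → Fin m → ℝ, (∀ j, 0 ≤ j → j < N → SqAdapted μ (F j) (u j)) ∧
      (u k = fun ω => ψ ω • v) ∧
      cost sys ((Weights.zero n m).toRandom Ω) μ N W 0 (fun _ => 0) u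
        = (∫ ω, (ψ ω - ∫ ω', ψ ω' ∂μ) ^ 2 ∂μ) * (v ⬝ᵥ Ups sys P k *ᵥ v)
          + (∫ ω, ψ ω ∂μ) ^ 2 * (v ⬝ᵥ UpsBar sys P Pi k *ᵥ v) := by
  set w := (Weights.zero n m).toRandom Ω with hwdef
  have hw : w.SquareIntegrable μ N := Weights.toRandom_squareIntegrable _
  have hψv : SqAdapted μ (F k) fun ω => ψ ω • v :=
    ⟨hψ.smul_const v, memLp_smul_const hψ2 v⟩
  -- The feedback is used at all times, with `ψ v` added at time `k`. Before that the state is still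
  -- zero and the feedback returns zero, so no case distinction in time is needed.
  obtain ⟨u, hu⟩ := exists_closedLoop sys μ W 0 (fun _ => (0 : Fin n → ℝ)) fun j x Ex ω =>
    linearFeedback sys P Pi j x Ex + if j = k then ψ ω • v else 0
  have hs : ∀ j, 0 ≤ j → j < N →
      SqAdapted μ (F j) fun ω => if j = k then ψ ω • v else (0 : Fin m → ℝ) := by
    intro j _ _
    by_cases h : j = k
    · subst h; simpa using hψv
    · simpa [h] using SqAdapted.const (μ := μ) (F := F j) (0 : Fin m → ℝ)
  have hx₀ : SqAdapted μ (F 0) (fun _ => (0 : Fin n → ℝ)) := SqAdapted.const _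
  have hadm := hF.sqAdapted_of_feedback (sys := sys) hx₀ hs fun j _ _ ω => hu j ω
  set x := state sys μ W 0 (fun _ => (0 : Fin n → ℝ)) u with hxdef
  have hx : ∀ j, 0 ≤ j → j < N → SqAdapted μ (F j) (x j) := fun j h1 h2 =>
    hF.sqAdapted_state hx₀ h1 h2.le fun i h3 h4 => hadm i h3 (h4.trans h2)
  have hu0 : ∀ j < k, (x j = fun _ => 0) → u j = fun _ => 0 := by
    intro j hj hxj
    funext ω
    rw [hu j ω, hxj, if_neg (by omega)]
    simp [linearFeedback]
  have hx0 : ∀ j ≤ k, x j = fun _ => 0 := by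
    intro j
    induction j with
    | zero => intro _; exact state_of_le le_rfl
    | succ j ih =>
      intro hj
      have hxj := ih (by omega)
      have huj := hu0 j hj hxj
      rw [hxdef, state_succ (Nat.zero_le _), ← hxdef, hxj, huj]
      funext ω
      simp [nextState, hb j]
  have huk : u k = fun ω => ψ ω • v := by
    funext ω
    rw [hu k ω, hx0 k le_rfl, if_pos rfl]
    simp [linearFeedback]
  have hrun0 : ∀ j ∈ Finset.Ico 0 k, runCost sys w μ j (x j) (u j) = 0 := by
    intro j hj
    have hjk := (Finset.mem_Ico.1 hj).2
    rw [hx0 j hjk.le, hu0 j hjk (hx0 j hjk.le)]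
    simp [runCost]
  have hη : IsLRESolution sys (Weights.zero n m) P Pi (fun _ => 0) N :=
    ⟨by simp [Weights.zero], fun j hj => by simp [zeta, Weights.zero, hb j]⟩
  have hA : AdjointFamily sys w μ P Pi W F (k + 1) N (fun _ _ => 0) (fun _ _ => 0)
      (fun _ _ => 0) (fun _ => 0) (fun _ => 0) := hη.adjointFamily
  have hζ : ∀ j, meanWeightControl sys w μ P Pi j 0 0 = 0 := fun j => by
    simp [meanWeightControl, hb j, hwdef, Weights.toRandom, Weights.zero]
  have hζ' : ∀ j, meanWeightState sys w μ P Pi j 0 0 = 0 := fun j => by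
    simp [meanWeightState, hb j, hwdef, Weights.toRandom, Weights.zero]
  have htail := hA.tail_cost_eq hk hG hΥ (fun j _ h2 => hF.noise j (Nat.zero_le _) h2) hw
    (fun j _ h2 => hx j (Nat.zero_le _) h2) (fun j _ h2 => hadm j (Nat.zero_le _) h2)
    (fun j _ _ => state_succ (Nat.zero_le _))
  -- From time `k + 1` on the control is the exact feedback and all weights vanish, so neither
  -- excess nor constants remain.
  rw [Finset.sum_eq_zero (s := Finset.Ico (k + 1) N) (f := fun j => excess sys μ P Pi j _ _ _ _ + _)
    (fun j hj => ?_), add_zero] at htail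
  swap
  · obtain ⟨h1, h2⟩ := Finset.mem_Ico.1 hj
    rw [hζ, excess_eq_zero_of_feedback (SqAdapted.const _) (by simp) (hx j (Nat.zero_le _) h2)]
    · simp [stepConst, hζ, hb j]
    · intro ω
      rw [hu j ω, if_neg (by omega)]
      simp
  have hadj : IsAdjointStep sys w μ (F k) (W k) k (fun _ => 0) (fun _ => 0) (fun _ => 0) 0 :=
    (hη.adjointFamily (W := W) (F := F) (l := k)).adjoint k le_rfl hk
  obtain ⟨hP, hPi⟩ := hG.isSymm (k + 1) hk
  -- At time `k` the identity before completing the square is used: invertibility of `Υ` and `Ῡ` at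
  -- `k` is not yet known.
  have hone := valueFn_nextState_add_runCost (y := 0) hP hPi (hF.noise k (Nat.zero_le _) hk)
    (hw.q k hk) (hw.qbar k hk) (hw.ρ k hk) (hw.ρbar k hk) (memLp_const _) (memLp_const _) hadj
    (hx k (Nat.zero_le _) hk) (hadm k (Nat.zero_le _) hk)
  have hψm : ∫ ω, ψ ω • v ∂μ = (∫ ω, ψ ω ∂μ) • v := integral_smul_const _ _
  have hc : ∀ ω, centred μ (fun ω => ψ ω • v) ω = (ψ ω - ∫ ω', ψ ω' ∂μ) • v := fun ω => by
    rw [centred, hψm, sub_smul]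
  refine ⟨u, hadm, huk, ?_⟩
  rw [cost_eq hF hx₀ (Nat.zero_le _) hw hadm,
    ← Finset.sum_Ico_consecutive _ (Nat.zero_le k) hk.le, Finset.sum_eq_zero hrun0,
    Finset.sum_eq_sum_Ico_succ_bot hk]
  have hnext : x (k + 1) = nextState sys μ k (W k) (x k) (u k) := state_succ (Nat.zero_le _)
  rw [← hnext, hx0 k le_rfl, huk, hψm] at hone
  simp only [hc, hζ, hζ', hb k, centred_const] at hone
  simp only [mulVec_zero, zero_dotProduct, dotProduct_zero, integral_zero, mulVec_smul,
    smul_dotProduct, dotProduct_smul, smul_eq_mul, mul_zero, add_zero, zero_add] at hone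
  have e : ∫ ω, (ψ ω - ∫ ω', ψ ω' ∂μ) * ((ψ ω - ∫ ω', ψ ω' ∂μ) * (v ⬝ᵥ Ups sys P k *ᵥ v)) ∂μ
      = (∫ ω, (ψ ω - ∫ ω', ψ ω' ∂μ) ^ 2 ∂μ) * (v ⬝ᵥ Ups sys P k *ᵥ v) := by
    rw [← integral_mul_const]
    congr 1
    funext ω
    ring
  rw [e] at hone
  rw [← hxdef, huk, hx0 k le_rfl]
  linarith

/-- Uniform convexity bounds the variance-weighted Riccati forms from below. -/
theorem quadratic_lower_bound (hF : NoiseFiltration μ N W 0 F)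
    (hb : ∀ k, sys.b k = 0 ∧ sys.σ k = 0) (hG : IsGRESolution sys P Pi N) {α : ℝ} (hα : 0 < α)
    (hconv : ∀ u : ℕ → Ω → Fin m → ℝ, (∀ j, 0 ≤ j → j < N → SqAdapted μ (F j) (u j)) →
      α * ∫ ω, ∑ k ∈ Finset.Ico 0 N, u k ω ⬝ᵥ u k ω ∂μ
        ≤ cost sys ((Weights.zero n m).toRandom Ω) μ N W 0 (fun _ => 0) u)
    {k : ℕ} (hk : k < N)
    (hΥ : ∀ j, k + 1 ≤ j → j < N → (Ups sys P j).PosDef ∧ (UpsBar sys P Pi j).PosDef)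
    {ψ : Ω → ℝ} (hψ : Measurable[F k] ψ) (hψ2 : MemLp ψ 2 μ) (v : Fin m → ℝ) :
    α * ((∫ ω, (ψ ω) ^ 2 ∂μ) * (v ⬝ᵥ v)) ≤
      (∫ ω, (ψ ω - ∫ ω', ψ ω' ∂μ) ^ 2 ∂μ) * (v ⬝ᵥ Ups sys P k *ᵥ v)
        + (∫ ω, ψ ω ∂μ) ^ 2 * (v ⬝ᵥ UpsBar sys P Pi k *ᵥ v) := by
  obtain ⟨u, hadm, huk, hcost⟩ := exists_control_cost_eq hF hb hG hk hΥ hψ hψ2 v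
  rw [← hcost]
  refine le_trans (mul_le_mul_of_nonneg_left ?_ hα.le) (hconv u hadm)
  have hi : ∀ j ∈ Finset.Ico 0 N, Integrable (fun ω => u j ω ⬝ᵥ u j ω) μ := fun j hj =>
    integrable_dotProduct (hadm j (Nat.zero_le _) (Finset.mem_Ico.1 hj).2).2
      (hadm j (Nat.zero_le _) (Finset.mem_Ico.1 hj).2).2
  rw [integral_finsetSum _ hi]
  -- Of the control energy only the term at time `k` is kept; the later feedback controls contribute
  -- nonnegative amounts.
  refine le_trans (le_of_eq ?_) (Finset.single_le_sum (f := fun j => ∫ ω, u j ω ⬝ᵥ u j ω ∂μ)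
    (fun j _ => integral_nonneg fun ω => ?_) (Finset.mem_Ico.2 ⟨Nat.zero_le k, hk⟩))
  · simp only [huk]
    rw [← integral_mul_const]
    congr 1
    funext ω
    simp only [smul_dotProduct, dotProduct_smul, smul_eq_mul]
    ring
  · simpa using dotProduct_star_self_nonneg (u j ω)

/-- Uniform convexity implies strong regularity, provided that the initial information supports a
nontrivial centred random variable. -/
theorem IsGRESolution.isStronglyRegular_of_convex (hF : NoiseFiltration μ N W 0 F)
    (hb : ∀ k, sys.b k = 0 ∧ sys.σ k = 0) (hG : IsGRESolution sys P Pi N) {α : ℝ} (hα : 0 < α)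
    (hconv : ∀ u : ℕ → Ω → Fin m → ℝ, (∀ j, 0 ≤ j → j < N → SqAdapted μ (F j) (u j)) →
      α * ∫ ω, ∑ k ∈ Finset.Ico 0 N, u k ω ⬝ᵥ u k ω ∂μ
        ≤ cost sys ((Weights.zero n m).toRandom Ω) μ N W 0 (fun _ => 0) u)
    {φ : Ω → ℝ} (hφ : ∀ k, Measurable[F k] φ) (hφ2 : MemLp φ 2 μ) (hφ0 : ∫ ω, φ ω ∂μ = 0)
    (hφp : 0 < ∫ ω, (φ ω) ^ 2 ∂μ) :
    IsStronglyRegular sys P Pi N := by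
  refine ⟨hG, α, hα, ?_⟩
  suffices H : ∀ k ≤ N, ∀ j, k ≤ j → j < N →
      (Ups sys P j - α • (1 : Matrix (Fin m) (Fin m) ℝ)).PosSemidef ∧
      (UpsBar sys P Pi j - α • (1 : Matrix (Fin m) (Fin m) ℝ)).PosSemidef from
    fun k hk => H 0 (Nat.zero_le _) k (Nat.zero_le _) hk
  intro k hk
  induction hk using Nat.decreasingInduction with
  | self => intro j h1 h2; omega
  | of_succ k hk ih =>
    intro j h1 h2
    rcases Nat.eq_or_lt_of_le h1 with rfl | h1
    swap
    · exact ih j h1 h2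
    have hΥ : ∀ j, k + 1 ≤ j → j < N → (Ups sys P j).PosDef ∧ (UpsBar sys P Pi j).PosDef :=
      fun j h1 h2 => ⟨posDef_of_sub_smul_one hα (ih j h1 h2).1,
        posDef_of_sub_smul_one hα (ih j h1 h2).2⟩
    obtain ⟨hP, hPi⟩ := hG.isSymm (k + 1) hk
    have psd : ∀ M : Matrix (Fin m) (Fin m) ℝ, M.IsSymm →
        (∀ v, α * (v ⬝ᵥ v) ≤ v ⬝ᵥ M *ᵥ v) →
        (M - α • (1 : Matrix (Fin m) (Fin m) ℝ)).PosSemidef := by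
      intro M hM hv
      refine .of_dotProduct_mulVec_nonneg ?_ fun v => ?_
      · rw [Matrix.IsHermitian, conjTranspose_eq_transpose_of_trivial]
        simp [hM.eq]
      · have := hv v
        simp only [star_trivial, sub_mulVec, smul_mulVec, one_mulVec, dotProduct_sub,
          dotProduct_smul, smul_eq_mul]
        linarith
    refine ⟨psd _ (ups_isSymm hP) fun v => ?_, psd _ (upsBar_isSymm hP hPi) fun v => ?_⟩
    -- A centred `ψ` removes the mean term and isolates `Υ`; below, `ψ = 1` has zero variance and
    -- isolates `Ῡ`. The same `α` serves at every time.
    · have := quadratic_lower_bound hF hb hG hα hconv hk hΥ (hφ k) hφ2 v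
      simp only [hφ0, sub_zero] at this
      refine le_of_mul_le_mul_left ?_ hφp
      linarith
    · have := quadratic_lower_bound hF hb hG hα hconv hk hΥ (ψ := fun _ => 1) measurable_const
        (memLp_const _) v
      simpa using this

/-- Some component of `ξ - 𝔼ξ` works: if all had zero variance, `ξ` would be almost surely constant.
Being a function of `ξ`, it is measurable for every history. -/
theorem exists_centred_of_not_const {l : ℕ} {ξ : Ω → Fin n → ℝ} (hξ : IsInitialState μ N W l ξ)
    (hc : ¬ ∃ c : Fin n → ℝ, ∀ᵐ ω ∂μ, ξ ω = c) :
    ∃ φ : Ω → ℝ, (∀ k, Measurable[history W l ξ k] φ) ∧ MemLp φ 2 μ ∧ ∫ ω, φ ω ∂μ = 0 ∧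
      0 < ∫ ω, (φ ω) ^ 2 ∂μ := by
  by_contra! hcon
  have hm : ∀ k, SqAdapted μ (history W l ξ k) (centred μ ξ) := fun k =>
    SqAdapted.centred ⟨(comap_measurable ξ).mono le_sup_left le_rfl, hξ.memLp⟩
  have hz : ∀ i, (fun ω => (centred μ ξ ω i) ^ 2) =ᵐ[μ] 0 := by
    intro i
    have hi := (hm l).2.eval i
    have h0 : ∫ ω, centred μ ξ ω i ∂μ = 0 := by
      rw [← eval_integral fun i => (hm l).integrable.eval i,
        integral_centred (hξ.memLp.integrable one_le_two)]
      rfl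
    have := hcon (fun ω => centred μ ξ ω i) (fun k => (measurable_pi_apply i).comp (hm k).1) hi h0
    exact (integral_eq_zero_iff_of_nonneg (fun _ => sq_nonneg _) hi.integrable_sq).1
      (le_antisymm this (integral_nonneg fun _ => sq_nonneg _))
  refine hc ⟨∫ ω, ξ ω ∂μ, ?_⟩
  filter_upwards [ae_all_iff.2 hz] with ω hω
  funext i
  have := pow_eq_zero_iff (two_ne_zero) |>.1 (hω i)
  simpa [centred, sub_eq_zero] using this

end Regularity

end MFLQ

theorem corollary4p2 {Ω : Type*} [MeasurableSpace Ω] (μ : MeasureTheory.Measure Ω)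
    [MeasureTheory.IsProbabilityMeasure μ] {n m : ℕ} (N : ℕ)
    (W : ℕ → Ω → ℝ) (hW : ∀ k < N, Measurable (W k))
    (sys : MFLQ.System n m)
    (ξ₀ : Ω → Fin n → ℝ) (hξ₀ : MFLQ.IsInitialState μ N W 0 ξ₀)
    (hξ₀_nonconst : ¬ ∃ c : Fin n → ℝ, ∀ᵐ ω ∂μ, ξ₀ ω = c)
    (hA2 : MFLQ.UniformlyConvexAt sys μ N W 0 ξ₀) :
    ∃ P Pi : ℕ → Matrix (Fin n) (Fin n) ℝ,
      -- `(P, Π)` is the unique strongly regular solution of the GRE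
      MFLQ.IsStronglyRegular sys P Pi N ∧
      (∀ P' Pi' : ℕ → Matrix (Fin n) (Fin n) ℝ, MFLQ.IsStronglyRegular sys P' Pi' N →
        ∀ k ≤ N, P' k = P k ∧ Pi' k = Pi k) ∧
      -- unique open-loop solvability at every initial pair
      (∀ w : MFLQ.RandomWeights Ω n m, w.SquareIntegrable μ N →
        ∀ l < N, ∀ ξ : Ω → Fin n → ℝ, MFLQ.IsInitialState μ N W l ξ →
          ∃ u : ℕ → Ω → Fin m → ℝ, MFLQ.IsUniqueOpenLoopOptimal sys w μ N W l ξ u) ∧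
      -- feedback form of the optimal control
      (∀ d : MFLQ.Weights n m,
        ∃ η : ℕ → Fin n → ℝ, MFLQ.IsLRESolution sys d P Pi η N ∧
          (∀ η' : ℕ → Fin n → ℝ, MFLQ.IsLRESolution sys d P Pi η' N →
            ∀ k ≤ N, η' k = η k) ∧
          ∀ l < N, ∀ ξ : Ω → Fin n → ℝ, MFLQ.IsInitialState μ N W l ξ →
            ∃ u : ℕ → Ω → Fin m → ℝ,
              MFLQ.IsUniqueOpenLoopOptimal sys (d.toRandom Ω) μ N W l ξ u ∧
              ∀ k, l ≤ k → k < N → ∀ ω,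
                u k ω =
                  MFLQ.linearFeedback sys P Pi k (MFLQ.state sys μ W l ξ u k ω)
                    (∫ ω', MFLQ.state sys μ W l ξ u k ω' ∂μ)
                  - (MFLQ.mpInv (MFLQ.UpsBar sys P Pi k)).mulVec
                      (MFLQ.zeta sys d P Pi η k)) ∧
      -- the homogeneous case
      ((∀ k < N, sys.b k = 0 ∧ sys.σ k = 0) →
        (∀ η : ℕ → Fin n → ℝ,
          MFLQ.IsLRESolution sys (MFLQ.Weights.zero n m) P Pi η N →
            (∀ k ≤ N, η k = 0) ∧
            (∀ k < N, MFLQ.zeta sys (MFLQ.Weights.zero n m) P Pi η k = 0)) ∧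
        ∀ l < N, ∀ ξ : Ω → Fin n → ℝ, MFLQ.IsInitialState μ N W l ξ →
          ∃ u : ℕ → Ω → Fin m → ℝ,
            MFLQ.IsUniqueOpenLoopOptimal sys ((MFLQ.Weights.zero n m).toRandom Ω) μ N W l ξ u ∧
            ∀ k, l ≤ k → k < N → ∀ ω,
              u k ω =
                MFLQ.linearFeedback sys P Pi k (MFLQ.state sys μ W l ξ u k ω)
                  (∫ ω', MFLQ.state sys μ W l ξ u k ω' ∂μ)) := by

  obtain ⟨P, Pi, hG⟩ := MFLQ.exists_isGRESolution sys N
  obtain ⟨α, hα, hconv⟩ := hA2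
  obtain ⟨φ, hφ, hφ2, hφ0, hφp⟩ := MFLQ.exists_centred_of_not_const hξ₀ hξ₀_nonconst
  -- The Riccati equations do not involve `b` and `σ`, so the solution is shared with the
  -- homogeneous system, to which the convexity hypothesis refers.
  have hG' : MFLQ.IsGRESolution sys.homogeneous P Pi N :=
    ⟨hG.terminal_P, hG.terminal_Pi, hG.step_P, hG.step_Pi⟩
  have hreg : MFLQ.IsStronglyRegular sys P Pi N :=
    -- The information is that of `ξ₀`, although the state in the convexity hypothesis starts at
    -- zero.
    ⟨hG, (hG'.isStronglyRegular_of_convex (hξ₀.noiseFiltration hW) (fun _ => ⟨rfl, rfl⟩) hα hconv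
      hφ hφ2 hφ0 hφp).2⟩
  obtain ⟨β, hβ, hβ'⟩ := hreg.2
  have hΥ : ∀ k < N, (MFLQ.Ups sys P k).PosDef ∧ (MFLQ.UpsBar sys P Pi k).PosDef := fun k hk =>
    ⟨MFLQ.posDef_of_sub_smul_one hβ (hβ' k hk).1, MFLQ.posDef_of_sub_smul_one hβ (hβ' k hk).2⟩
  refine ⟨P, Pi, hreg, fun P' Pi' h' => hG.unique h'.1, ?_, ?_, fun hb => ⟨?_, ?_⟩⟩
  · intro w hw l hl ξ hξ
    exact MFLQ.exists_isUniqueOpenLoopOptimal hl.le hG hΥ hW hξ hw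
  · intro d
    obtain ⟨η, hη⟩ := MFLQ.exists_isLRESolution (sys := sys) d P Pi N
    refine ⟨η, hη, fun η' h' => hη.unique h', fun l hl ξ hξ => ?_⟩
    obtain ⟨u, hu, hfb⟩ := hη.exists_isUniqueOpenLoopOptimal hl.le hG hΥ hW hξ
    exact ⟨u, hu, fun k _ _ ω => hfb k ω⟩
  · exact fun η hη => hη.eq_zero hb
  · intro l hl ξ hξ
    obtain ⟨η, hη⟩ := MFLQ.exists_isLRESolution (sys := sys) (MFLQ.Weights.zero n m) P Pi N
    obtain ⟨u, hu, hfb⟩ := hη.exists_isUniqueOpenLoopOptimal hl.le hG hΥ hW hξ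
    refine ⟨u, hu, fun k _ hk ω => ?_⟩
    rw [hfb k ω, (hη.eq_zero hb).2 k hk, Matrix.mulVec_zero, sub_zero]
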